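/- Let $d\ge 2$ and let $\Omega\subset\mathbb{R}^d$ be an open set such that: * $\partial\Omega$ is weakly lower Ahlfors--David $(d-1)$-regular, i.e. for $\mathcal H^{d-1}$-a.e. $x\in\partial\Omega$ there is $\rho>0$ with $$\inf\left\{\frac{\mathcal H^{d-1}(\partial\Omega\cap B(y,r))}{r^{d-1}} : y\in\partial\Omega\cap B(x,\rho),\ 0<r<\rho\right\}>0; \qquad (1)$$ * $\mathcal H^{d-1}|_{\partial\Omega}$ is locally finite; * $\mathcal H^{d-1}(\partial\Omega\setminus\partial^*\Omega)=0$, where $\partial^*\Omega$ is the reduced boundary of $\Omega$, i.e. the set of all points $x$ with $\|\partial\Omega\|(B(x,r))>0$ for all $r>0$ such that, as $r\to0$, the averages $\|\partial\Omega\|(B(x,r))^{-1}\int_{B(x,r)}\nu_\Omega\,d\|\partial\Omega\|$ converge to a unit vector. Here $\|\partial\Omega\|$ is the perimeter measure and $\nu_\Omega$ the measure theoretic outer unit normal, determined by $\int_\Omega\operatorname{div}\varphi\,dx=\int\varphi\cdot\nu_\Omega\,d\|\partial\Omega\|$ for all $\varphi\in C_c^\infty(\mathbb{R}^d;\mathbb{R}^d)$.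 Fix $s\in(0,1/3)$, and let $\mathcal K$ be the set of all $\xi\in\partial\Omega$ at which $\partial\Omega$ has an $s$-approximate tangent $(d-1)$-plane, i.e. for which $$\limsup_{r\to0}\frac{\mathcal H^{d-1}(\partial\Omega\cap B(\xi,r))}{r^{d-1}}>0$$ and there is a $(d-1)$-dimensional linear subspace $V\subset\mathbb{R}^d$ with $$\lim_{r\to0}\frac{\mathcal H^{d-1}\big(\{x\in\partial\Omega\cap B(\xi,r): |\pi_{V^\perp}(x-\xi)|\ge s|x-\xi|\}\big)}{r^{d-1}}=0 .$$ Then there is a countable collection $\{\Gamma_j\}$ of $(d-1)$-dimensional Lipschitz graphs (graphs of Lipschitz functions $A\to V^\perp$ on arbitrary subsets $A$ of $(d-1)$-dimensional linear subspaces $V$ of $\mathbb{R}^d$) such that $$\bigcup_j\Gamma_j=\{\xi\in\mathcal K\cap\partial^*\Omega:\ \text{(1) holds at } x=\xi \text{ for some } \rho>0\},\qquad \mathcal H^{d-1}\Big(\mathcal K\setminus\bigcup_j\Gamma_j\Big)=0,$$ and for each $j$ there is a bounded Lipschitz domain $\Omega_{\Gamma_j}\subset\Omega$ with $\Gamma_j\subset\partial\Omega_{\Gamma_j}$.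 (A bounded Lipschitz domain is a bounded, nonempty, connected open set that near each of its boundary points is, in suitable rotated coordinates, the region above the graph of a Lipschitz function of $d-1$ variables.) -/

import Mathlib

open MeasureTheory Filter Topology Set
open scoped ENNReal NNReal ContDiff RealInnerProductSpace

noncomputable section

namespace LipGraphs

/-- Euclidean space `ℝ^d`. -/
abbrev Euc (d : ℕ) : Type := EuclideanSpace ℝ (Fin d)

variable {d : ℕ}

/-! ### Weak lower Ahlfors-David regularity and approximate tangent planes -/

/-- The lower regularity condition at the point `x` of `E`: for some `ρ > 0`,
`inf { ℋ^m(E ∩ B(y,r)) / r^m : y ∈ E ∩ B(x,ρ), 0 < r < ρ } > 0`. -/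
def WeakLowerRegularAt (m : ℕ) (E : Set (Euc d)) (x : Euc d) : Prop :=
  ∃ ρ : ℝ, 0 < ρ ∧
    0 < ⨅ y ∈ E ∩ Metric.ball x ρ, ⨅ r ∈ Ioo (0 : ℝ) ρ,
      μH[(m : ℝ)] (E ∩ Metric.ball y r) / ENNReal.ofReal (r ^ m)

/-- `E` is weakly lower Ahlfors-David `m`-regular: the lower regularity condition holds at
`ℋ^m`-almost every point of `E`. -/
def WeakLowerADR (m : ℕ) (E : Set (Euc d)) : Prop :=
  μH[(m : ℝ)] {x ∈ E | ¬ WeakLowerRegularAt m E x} = 0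

/-- The upper `m`-density of `E` at `x`. -/
def upperDensity (m : ℕ) (E : Set (Euc d)) (x : Euc d) : ℝ≥0∞ :=
  limsup (fun r : ℝ => μH[(m : ℝ)] (E ∩ Metric.ball x r) / ENNReal.ofReal (r ^ m)) (𝓝[>] 0)

/-- The cone `X(ξ, V, s)` around `ξ + V` with vertex `ξ` and aperture `s`. -/
def tangentCone (ξ : Euc d) (V : Submodule ℝ (Euc d)) (s : ℝ) : Set (Euc d) :=
  {x | ‖Vᗮ.starProjection (x - ξ)‖ < s * ‖x - ξ‖}

/-- The linear subspace `V` is an `s`-approximate tangent `m`-plane for `E` at `ξ`. -/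
def IsApproxTangentPlane (m : ℕ) (s : ℝ) (E : Set (Euc d)) (ξ : Euc d)
    (V : Submodule ℝ (Euc d)) : Prop :=
  Module.finrank ℝ V = m ∧ 0 < upperDensity m E ξ ∧
    Tendsto (fun r : ℝ => μH[(m : ℝ)] ((E ∩ Metric.ball ξ r) \ tangentCone ξ V s) /
      ENNReal.ofReal (r ^ m)) (𝓝[>] 0) (𝓝 0)

/-- The set of all points of `E` at which `E` has an `s`-approximate tangent `m`-plane. -/
def tangentPoints (m : ℕ) (s : ℝ) (E : Set (Euc d)) : Set (Euc d) :=
  {ξ ∈ E | ∃ V : Submodule ℝ (Euc d), IsApproxTangentPlane m s E ξ V}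

/-! ### The reduced boundary -/

/-- The divergence of a vector field on `ℝ^d`. -/
def divergence (φ : Euc d → Euc d) (x : Euc d) : ℝ :=
  ∑ i : Fin d, (fderiv ℝ φ x (EuclideanSpace.single i 1)) i

/-- `μ` is the perimeter measure `‖∂E‖` of `E`, and `ν` is (a representative of) the measure
theoretic outer unit normal `ν_E`.  Such a pair exists if and only if the measurable set `E` has
locally finite perimeter; then `μ` is unique, and `ν` is unique up to `μ`-null sets. -/
structure IsPerimeterPair (E : Set (Euc d)) (μ : Measure (Euc d)) (ν : Euc d → Euc d) :
    Prop where
  locallyFinite : IsLocallyFiniteMeasure μ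
  measurable : Measurable ν
  norm_eq_one : ∀ᵐ x ∂μ, ‖ν x‖ = 1
  gauss_green : ∀ φ : Euc d → Euc d, ContDiff ℝ ∞ φ → HasCompactSupport φ →
    ∫ x in E, divergence φ x = ∫ x, ⟪φ x, ν x⟫ ∂μ

/-- The reduced boundary `∂*E` of `E`: the points `x` with `‖∂E‖(B(x,r)) > 0` for all `r > 0`
at which the averages of `ν_E` over `B(x,r)` with respect to `‖∂E‖` converge, as `r → 0`, to
`ν_E(x)`, with `|ν_E(x)| = 1`.  (The representative of `ν_E` may be adjusted at the point `x`,
so that `x ∈ ∂*E` means that these averages have a limit of norm one.) -/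
def reducedBoundary (E : Set (Euc d)) : Set (Euc d) :=
  {x | ∃ (μ : Measure (Euc d)) (ν : Euc d → Euc d), IsPerimeterPair E μ ν ∧
    (∀ r : ℝ, 0 < r → 0 < μ (Metric.ball x r)) ∧
    Tendsto (fun r : ℝ => ⨍ y in Metric.ball x r, ν y ∂μ) (𝓝[>] 0) (𝓝 (ν x)) ∧
    ‖ν x‖ = 1}

/-! ### Lipschitz graphs and Lipschitz domains -/

/-- `Γ` is an `m`-dimensional Lipschitz graph: the graph of a Lipschitz function `φ : A → Vᗮ`
that is defined on a subset `A` of an `m`-dimensional linear subspace `V`. -/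
def IsLipschitzGraph (m : ℕ) (Γ : Set (Euc d)) : Prop :=
  ∃ V : Submodule ℝ (Euc d), Module.finrank ℝ V = m ∧
    ∃ (A : Set V) (φ : V → Vᗮ) (L : ℝ≥0), LipschitzOnWith L φ A ∧
      Γ = (fun v : V => (v : Euc d) + (φ v : Euc d)) '' A

/-- `D` is a bounded Lipschitz domain: a bounded, open, connected, nonempty set which near each
of its boundary points is, in suitable rotated coordinates, the region above the graph of a
Lipschitz function of `d - 1` variables. -/
structure IsBoundedLipschitzDomain (D : Set (Euc d)) : Prop where
  isOpen : IsOpen D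
  isConnected : IsConnected D
  isBounded : Bornology.IsBounded D
  graph : ∀ p ∈ frontier D, ∃ (e : Euc d) (r : ℝ) (L : ℝ≥0) (ψ : (ℝ ∙ e)ᗮ → ℝ),
    ‖e‖ = 1 ∧ 0 < r ∧ LipschitzWith L ψ ∧
      D ∩ Metric.ball p r =
        {x | ψ ((ℝ ∙ e)ᗮ.orthogonalProjectionOnto x) < ⟪e, x⟫} ∩ Metric.ball p r

end LipGraphs

end

/-! Let ξ be a boundary point in the reduced boundary at which lower regularity holds and an
s-approximate tangent plane exists. Lower regularity upgrades the approximate tangent plane to a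
genuine one: a boundary point outside a slightly wider cone would carry a ball full of boundary
mass, against the vanishing density outside the cone (`exists_forall_norm_starProjection_le`). So
near ξ both components of the complement of the cone avoid the boundary, and each lies in Ω or
misses it.

They cannot both miss Ω (`not_mem_reducedBoundary_of_subset_cone`). In the reduced boundary the
normal is nearly constant, equal to n, in the mean on small balls. Testing Gauss–Green with a cutoff
times n bounds the perimeter by the volume of Ω. Together with the Sobolev inequality for functions
of bounded variation and De Giorgi's iteration, this bounds the volume of Ω in B(ξ,r) below by a
multiple of r^d. If Ω lay in a thin cone around a hyperplane with unit normal e, signed so that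
⟪e,n⟫ ≤ 0, a bump field along e would have nonnegative divergence on Ω, bounded below near ξ, while
its flux is at most the integral of |ν - n|, which is negligible. This contradicts the volume bound.

Hence Ω contains a truncated cone with vertex ξ (`exists_truncCone_subset`). Rounding axis, height
and position to countably many values splits the set into pieces. No point of a piece lies in the
cone of another, so each piece is a Lipschitz graph, and the union of its congruent cones is
star-shaped about a whole ball, hence a Lipschitz domain inside Ω with the piece on its boundary. -/

namespace LipGraphs

/-! ### Truncated cones. -/

section Cones

variable {E : Type*} [NormedAddCommGroup E] [InnerProductSpace ℝ E]

/-- The open cone with vertex `ξ`, axis `e` and aperture `t`, truncated at distance `R`. -/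
def truncCone (ξ e : E) (t R : ℝ) : Set E :=
  {x | t * ‖x - ξ‖ < ⟪e, x - ξ⟫} ∩ Metric.ball ξ R

theorem isOpen_truncCone (ξ e : E) (t R : ℝ) : IsOpen (truncCone ξ e t R) :=
  (isOpen_lt (by fun_prop) (by fun_prop)).inter Metric.isOpen_ball

theorem convex_truncCone (ξ e : E) {t : ℝ} (ht : 0 ≤ t) (R : ℝ) :
    Convex ℝ (truncCone ξ e t R) := by
  refine Convex.inter ?_ (convex_ball ξ R)
  intro x hx y hy a b ha hb hab
  simp only [mem_ofPred_eq] at *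
  have h1 : a • x + b • y - ξ = a • (x - ξ) + b • (y - ξ) := by
    rw [smul_sub, smul_sub]
    have : ξ = a • ξ + b • ξ := by rw [← add_smul, hab, one_smul]
    nth_rewrite 1 [this]; abel
  rw [h1, inner_add_right, inner_smul_right, inner_smul_right]
  have h2 : ‖a • (x - ξ) + b • (y - ξ)‖ ≤ a * ‖x - ξ‖ + b * ‖y - ξ‖ := by
    refine (norm_add_le _ _).trans ?_
    rw [norm_smul, norm_smul, Real.norm_of_nonneg ha, Real.norm_of_nonneg hb]
  have h3 := mul_le_mul_of_nonneg_left h2 ht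
  rcases ha.eq_or_lt with rfl | ha
  · have : b = 1 := by linarith
    subst this; simp at h3 ⊢; linarith
  · nlinarith

theorem ball_subset_truncCone (ξ : E) {e : E} (he : ‖e‖ = 1) (R : ℝ) :
    Metric.ball (ξ + (R / 2) • e) (R / 8) ⊆ truncCone ξ e (1 / 2) R := by
  intro x hx
  rw [Metric.mem_ball, dist_eq_norm] at hx
  set w := x - (ξ + (R / 2) • e) with hw
  have hR : 0 < R := by have := (norm_nonneg _).trans_lt hx; linarith
  have hxw : x - ξ = (R / 2) • e + w := by rw [hw]; abel
  have h1 : ‖(R / 2) • e‖ = R / 2 := by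
    rw [norm_smul, he, Real.norm_of_nonneg (by linarith), mul_one]
  have h2 : ‖x - ξ‖ ≤ R / 2 + ‖w‖ := by rw [hxw]; refine (norm_add_le _ _).trans ?_; rw [h1]
  have h3 : ⟪e, x - ξ⟫ = R / 2 + ⟪e, w⟫ := by
    rw [hxw, inner_add_right, inner_smul_right, real_inner_self_eq_norm_sq, he]; ring
  have h4 : -‖w‖ ≤ ⟪e, w⟫ := by
    have := abs_real_inner_le_norm e w
    rw [he, one_mul] at this
    exact (abs_le.1 this).1
  refine ⟨?_, ?_⟩
  · simp only [mem_ofPred_eq]; rw [h3]; linarith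
  · rw [Metric.mem_ball, dist_eq_norm]; linarith

/-- The tolerance is 1/6 = 1/2 - 1/3. It allows the axis to be replaced by one from a countable
dense set of directions. -/
theorem truncCone_subset_of_norm_sub_lt (ξ : E) {e e' : E} (h : ‖e' - e‖ ≤ 1 / 6) (R : ℝ) :
    truncCone ξ e' (1 / 2) R ⊆ truncCone ξ e (1 / 3) R := by
  rintro x ⟨hx, hR⟩
  refine ⟨?_, hR⟩
  simp only [mem_ofPred_eq] at *
  have h1 : ⟪e', x - ξ⟫ = ⟪e, x - ξ⟫ + ⟪e' - e, x - ξ⟫ := by rw [inner_sub_left]; ring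
  have h2 : ⟪e' - e, x - ξ⟫ ≤ 1 / 6 * ‖x - ξ‖ :=
    (real_inner_le_norm _ _).trans (mul_le_mul_of_nonneg_right h (norm_nonneg _))
  linarith

theorem truncCone_mono (ξ e : E) (t : ℝ) {R R' : ℝ} (h : R ≤ R') :
    truncCone ξ e t R ⊆ truncCone ξ e t R' :=
  inter_subset_inter_right _ (Metric.ball_subset_ball h)

theorem mem_closure_truncCone (ξ : E) {e : E} (he : ‖e‖ = 1) {t R : ℝ} (ht : t < 1) (hR : 0 < R) :
    ξ ∈ closure (truncCone ξ e t R) := by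
  have h1 : Tendsto (fun a : ℝ => ξ + a • e) (𝓝[>] 0) (𝓝 ξ) := by
    have : Continuous (fun a : ℝ => ξ + a • e) := by fun_prop
    have := (this.tendsto 0).mono_left (nhdsWithin_le_nhds (s := Ioi 0))
    simpa using this
  refine mem_closure_of_tendsto h1 ?_
  filter_upwards [Ioo_mem_nhdsGT hR] with a ha
  refine ⟨?_, ?_⟩
  · simp only [mem_ofPred_eq, add_sub_cancel_left, norm_smul, inner_smul_right, he,
      real_inner_self_eq_norm_sq, Real.norm_of_nonneg ha.1.le]
    nlinarith [ha.1]
  · rw [Metric.mem_ball, dist_eq_norm, add_sub_cancel_left, norm_smul, he,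
      Real.norm_of_nonneg ha.1.le, mul_one]
    exact ha.2

end Cones

/-! ### Lipschitz domains and Lipschitz graphs from cone conditions. -/

section Epigraph

variable {E : Type*} [NormedAddCommGroup E] [InnerProductSpace ℝ E]

theorem norm_sq_eq_norm_sq_orthogonalProjectionOnto_add_inner_sq {e : E} (he : ‖e‖ = 1) (x : E) :
    ‖x‖ ^ 2 = ‖(ℝ ∙ e)ᗮ.orthogonalProjectionOnto x‖ ^ 2 + ⟪e, x⟫ ^ 2 := by
  have h := Submodule.norm_sq_eq_add_norm_sq_starProjection x (ℝ ∙ e)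
  rw [Submodule.starProjection_unit_singleton ℝ he, norm_smul, he, mul_one, Real.norm_eq_abs,
    sq_abs, Submodule.starProjection_apply] at h
  rw [h, Submodule.coe_norm, add_comm]

/-- A set satisfying a uniform interior cone condition with axis `e` near `p` is locally the
region above a Lipschitz graph. -/
theorem exists_lipschitz_epigraph_of_cone_condition {D : Set E} (hD : IsOpen D) {p e : E}
    (he : ‖e‖ = 1) {r : ℝ} {L : ℝ≥0} (hr : 0 < r) (hp : p ∈ closure D)
    (h : ∀ x ∈ D ∩ Metric.ball p r, ∀ y, L * ‖(ℝ ∙ e)ᗮ.orthogonalProjectionOnto y‖ < ⟪e, y⟫ →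
      ‖y‖ < 2 * r → x + y ∈ D) :
    ∃ ψ : (ℝ ∙ e)ᗮ → ℝ, LipschitzWith L ψ ∧ D ∩ Metric.ball p r =
      {x | ψ ((ℝ ∙ e)ᗮ.orthogonalProjectionOnto x) < ⟪e, x⟫} ∩ Metric.ball p r := by
  set P := (ℝ ∙ e)ᗮ.orthogonalProjectionOnto with hP
  let S := D ∩ Metric.ball p r
  have hne : S.Nonempty := by
    obtain ⟨x, hx, hxD⟩ := mem_closure_iff.1 hp _ Metric.isOpen_ball (Metric.mem_ball_self hr)
    exact ⟨x, hxD, hx⟩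
  have : Nonempty S := hne.to_subtype
  -- The graph function is the lower envelope of the upward cones of slope `L` with vertices in the
  -- set, so it is `L`-Lipschitz as an infimum of such functions.
  let f : (ℝ ∙ e)ᗮ → S → ℝ := fun v x => ⟪e, (x : E)⟫ + L * ‖v - P x‖
  have hbdd : ∀ v, BddBelow (range (f v)) := by
    intro v
    refine ⟨-(‖p‖ + r), ?_⟩
    rintro _ ⟨x, rfl⟩
    have h1 : ‖(x : E)‖ ≤ ‖p‖ + r := by
      have := x.2.2
      rw [Metric.mem_ball, dist_eq_norm] at this
      calc ‖(x : E)‖ = ‖p + ((x : E) - p)‖ := by congr 1; abel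
        _ ≤ _ := norm_add_le _ _
        _ ≤ _ := by linarith
    have h2 := (abs_le.1 ((abs_real_inner_le_norm e (x : E)))).1
    rw [he, one_mul] at h2
    have h3 : 0 ≤ L * ‖v - P x‖ := by positivity
    simp only [f]; linarith
  refine ⟨fun v => ⨅ x, f v x, ?_, ?_⟩
  · refine LipschitzWith.of_le_add_mul _ fun v w => ?_
    rw [← sub_le_iff_le_add]
    refine le_ciInf fun x => ?_
    rw [sub_le_iff_le_add]
    refine (ciInf_le (hbdd v) x).trans ?_
    simp only [f]
    have h1 : ‖v - P x‖ ≤ ‖w - P x‖ + dist v w := by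
      rw [dist_eq_norm]
      calc ‖v - P x‖ = ‖(w - P x) + (v - w)‖ := by congr 1; abel
        _ ≤ _ := norm_add_le _ _
    have := mul_le_mul_of_nonneg_left h1 L.2
    simp only [NNReal.val_eq_coe] at this
    linarith
  · ext x
    constructor
    · rintro ⟨hxD, hxB⟩
      refine ⟨?_, hxB⟩
      -- Openness gives a point of the set strictly below `x` on the same vertical line, which makes
      -- the inequality strict.
      have h1 : Tendsto (fun a : ℝ => x - a • e) (𝓝[>] 0) (𝓝 x) := by
        have : Continuous (fun a : ℝ => x - a • e) := by fun_prop
        have := (this.tendsto 0).mono_left (nhdsWithin_le_nhds (s := Ioi 0))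
        simpa using this
      obtain ⟨a, ha, ha0⟩ := ((h1.eventually ((hD.inter Metric.isOpen_ball).mem_nhds
        ⟨hxD, hxB⟩)).and self_mem_nhdsWithin).exists
      refine (ciInf_le (hbdd _) ⟨x - a • e, ha⟩).trans_lt ?_
      have hPe : P e = 0 := by
        rw [hP]
        exact Submodule.orthogonalProjectionOnto_orthogonalComplement_singleton_eq_zero e
      simp only [f, inner_sub_right, inner_smul_right, real_inner_self_eq_norm_sq, he, map_sub,
        map_smul, hPe]
      have : 0 < a := ha0
      simpa using this
    · rintro ⟨hx, hxB⟩
      refine ⟨?_, hxB⟩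
      simp only [mem_ofPred_eq] at hx
      obtain ⟨z, hz⟩ := exists_lt_of_ciInf_lt hx
      have := h z z.2 (x - z) (by
        simp only [f] at hz
        rw [map_sub, inner_sub_right]; linarith) (by
        have h1 := z.2.2
        rw [Metric.mem_ball] at h1 hxB
        rw [← dist_eq_norm]
        linarith [dist_triangle_right x (z : E) p])
      simpa using this

end Epigraph

variable {d : ℕ}

/-- The segments from a point near the boundary point p to all of the ball stay in the set, so they
sweep out a cone with axis c - p. This is a uniform interior cone condition near p. -/
theorem isBoundedLipschitzDomain_of_starConvex_ball {D : Set (Euc d)} (hD : IsOpen D)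
    (hb : Bornology.IsBounded D) {c : Euc d} {ρ : ℝ} (hρ : 0 < ρ) (hc : Metric.ball c ρ ⊆ D)
    (hs : ∀ b ∈ Metric.ball c ρ, StarConvex ℝ b D) : IsBoundedLipschitzDomain D := by
  refine ⟨hD, ⟨⟨c, hc (Metric.mem_ball_self hρ)⟩, ?_⟩, hb, ?_⟩
  · exact ((hs c (Metric.mem_ball_self hρ)).isPathConnected
      (hc (Metric.mem_ball_self hρ))).isConnected.isPreconnected
  · intro p hp
    have hpD : p ∉ D := by
      rw [hD.frontier_eq] at hp; exact hp.2
    have hcp : ρ ≤ ‖c - p‖ := by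
      by_contra! hlt
      exact hpD (hc (by rwa [Metric.mem_ball, dist_comm, dist_eq_norm]))
    set N := ‖c - p‖ with hN
    have hN0 : 0 < N := hρ.trans_le hcp
    let e := N⁻¹ • (c - p)
    have he : ‖e‖ = 1 := by
      rw [norm_smul, norm_inv, Real.norm_of_nonneg hN0.le, ← hN, inv_mul_cancel₀ hN0.ne']
    let L : ℝ≥0 := ⟨2 * N / ρ, by positivity⟩
    have hL : (L : ℝ) = 2 * N / ρ := rfl
    have hr : 0 < ρ / 2 := by linarith
    obtain ⟨ψ, hψ, hEq⟩ := exists_lipschitz_epigraph_of_cone_condition (L := L) hD he hr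
      (frontier_subset_closure hp) (by
      rintro x ⟨hxD, hxB⟩ y hy hyr
      set t := ⟪e, y⟫ with ht
      set w := y - t • e with hw
      have hwn : ‖(ℝ ∙ e)ᗮ.orthogonalProjectionOnto y‖ = ‖w‖ := by
        rw [Submodule.coe_norm, ← Submodule.starProjection_apply,
          Submodule.starProjection_orthogonal_val, Submodule.starProjection_unit_singleton ℝ he]
      rw [hwn, hL] at hy
      have ht0 : 0 < t := lt_of_le_of_lt (by positivity) hy
      have htN : t < N := by
        have := real_inner_le_norm e y
        rw [he, one_mul] at this
        linarith
      -- The ray from `x` along `y`, prolonged to height `N`, lands in the ball: `x - p` and the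
      -- sideways drift `(N / t) • w` each cost less than ρ/2. Then `x + y` lies on a segment from
      -- that landing point to `x`.
      have hb : x + (N / t) • y ∈ Metric.ball c ρ := by
        have h1 : x + (N / t) • y - c = (x - p) + (N / t) • w := by
          have h2 : (N / t) • (t • e) = c - p := by
            rw [smul_smul, div_mul_cancel₀ _ ht0.ne', smul_smul, mul_inv_cancel₀ hN0.ne', one_smul]
          rw [hw, smul_sub, h2]; abel
        rw [Metric.mem_ball, dist_eq_norm] at hxB
        rw [Metric.mem_ball, dist_eq_norm, h1]
        have h3 : ‖(N / t) • w‖ < ρ / 2 := by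
          rw [norm_smul, Real.norm_of_nonneg (by positivity)]
          have h4 : ‖w‖ * (2 * N) < t * ρ := by
            rw [div_mul_eq_mul_div, div_lt_iff₀ hρ] at hy
            linarith
          rw [div_mul_eq_mul_div, div_lt_iff₀ ht0]
          linarith
        linarith [norm_add_le (x - p) ((N / t) • w)]
      have h5 := hs _ hb hxD (show 0 ≤ t / N by positivity)
        (show 0 ≤ 1 - t / N by rw [sub_nonneg, div_le_one hN0]; exact htN.le) (by ring)
      convert h5 using 1
      rw [smul_add, smul_smul, div_mul_div_cancel₀ hN0.ne', div_self ht0.ne', one_smul, sub_smul,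
        one_smul]
      abel)
    exact ⟨e, ρ / 2, L, ψ, he, hr, hψ, hEq⟩

theorem isLipschitzGraph_of_inner_le {Γ : Set (Euc d)} {e : Euc d} (he : ‖e‖ = 1)
    (h : ∀ x ∈ Γ, ∀ y ∈ Γ, ⟪e, y - x⟫ ≤ 1 / 2 * ‖y - x‖) : IsLipschitzGraph (d - 1) Γ := by
  set V := (ℝ ∙ e)ᗮ with hV
  have he0 : e ≠ 0 := by rintro rfl; simp at he
  have hrank : Module.finrank ℝ V = d - 1 := by
    have h1 := Submodule.finrank_add_finrank_orthogonal (ℝ ∙ e)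
    rw [finrank_span_singleton he0, finrank_euclideanSpace_fin, ← hV] at h1
    omega
  set P := V.orthogonalProjectionOnto with hP
  set Q := Vᗮ.orthogonalProjectionOnto with hQ
  have hsum : ∀ x : Euc d, (P x : Euc d) + (Q x : Euc d) = x := fun x =>
    Submodule.starProjection_add_starProjection_orthogonal x
  have hQn : ∀ x ∈ Γ, ∀ y ∈ Γ, ‖Q y - Q x‖ ≤ ‖P y - P x‖ := by
    intro x hx y hy
    have h1 := norm_sq_eq_norm_sq_orthogonalProjectionOnto_add_inner_sq he (y - x)
    have h2 := Submodule.norm_sq_eq_add_norm_sq_starProjection (y - x) V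
    rw [Submodule.starProjection_apply, Submodule.starProjection_apply, ← Submodule.coe_norm,
      ← Submodule.coe_norm] at h2
    have h3 := h x hx y hy
    have h4 := h y hy x hx
    have h5 : ⟪e, x - y⟫ = - ⟪e, y - x⟫ := by rw [← inner_neg_right, neg_sub]
    rw [h5, norm_sub_rev] at h4
    have h6 : ⟪e, y - x⟫ ^ 2 ≤ (1 / 2 * ‖y - x‖) ^ 2 := sq_le_sq' (by linarith) h3
    rw [← map_sub, ← map_sub]
    refine (sq_le_sq₀ (norm_nonneg _) (norm_nonneg _)).1 ?_
    rw [← hP] at h1 h2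
    rw [← hQ] at h2
    nlinarith [sq_nonneg ‖y - x‖]
  -- By `hQn` the vertical displacement is at most the horizontal one, so points with equal
  -- projection coincide and the choice of preimage is immaterial.
  refine ⟨V, hrank, P '' Γ, fun v => Q (Function.invFunOn P Γ v), 1, ?_, ?_⟩
  · refine LipschitzOnWith.of_dist_le_mul fun v hv w hw => ?_
    rw [dist_eq_norm, dist_eq_norm, NNReal.coe_one, one_mul]
    have := hQn _ (Function.invFunOn_mem hw) _ (Function.invFunOn_mem hv)
    rwa [Function.invFunOn_eq hw, Function.invFunOn_eq hv] at this
  · rw [image_image]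
    have : ∀ x ∈ Γ, ((P x : Euc d) + (Q (Function.invFunOn P Γ (P x)) : Euc d)) = x := by
      intro x hx
      have hm : P x ∈ P '' Γ := ⟨x, hx, rfl⟩
      have h1 := hQn _ hx _ (Function.invFunOn_mem hm)
      rw [Function.invFunOn_eq hm, sub_self, norm_zero, norm_le_zero_iff, sub_eq_zero] at h1
      rw [h1, hsum]
    exact ((image_congr this).trans (image_id _)).symm

/-- A union of congruent truncated cones with parallel axes and nearby vertices is a bounded
Lipschitz domain. -/
theorem isBoundedLipschitzDomain_iUnion_truncCone {Γ : Set (Euc d)} (hne : Γ.Nonempty)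
    {e : Euc d} (he : ‖e‖ = 1) {R : ℝ} (hR : 0 < R) {q : Euc d}
    (hΓ : Γ ⊆ Metric.ball q (R / 16)) :
    IsBoundedLipschitzDomain (⋃ ξ ∈ Γ, truncCone ξ e (1 / 2) R) := by
  -- Each cone contains a ball of radius R/8 about its own midpoint. Vertices differ from `q` by
  -- less than R/16, so a ball of radius R/16 is common to all, and convexity of the cones makes the
  -- union star-shaped about its points.
  have hsub : ∀ ξ ∈ Γ, Metric.ball (q + (R / 2) • e) (R / 16) ⊆ truncCone ξ e (1 / 2) R := by
    intro ξ hξ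
    refine Subset.trans ?_ (ball_subset_truncCone ξ he R)
    refine Metric.ball_subset_ball' ?_
    have := hΓ hξ
    rw [dist_add_right, dist_comm]
    rw [Metric.mem_ball] at this
    linarith
  refine isBoundedLipschitzDomain_of_starConvex_ball
    (isOpen_biUnion fun ξ _ => isOpen_truncCone ξ e _ R) ?_ (c := q + (R / 2) • e)
    (ρ := R / 16) (by linarith) ?_ ?_
  · refine (Metric.isBounded_ball (x := q) (r := 2 * R)).subset ?_
    refine iUnion₂_subset fun ξ hξ => inter_subset_right.trans (Metric.ball_subset_ball' ?_)
    have := hΓ hξ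
    rw [Metric.mem_ball] at this
    linarith
  · obtain ⟨ξ, hξ⟩ := hne
    exact (hsub ξ hξ).trans (subset_biUnion_of_mem (u := fun ξ => truncCone ξ e (1 / 2) R) hξ)
  · intro b hb
    exact starConvex_iUnion₂ fun ξ hξ => (convex_truncCone ξ e (by norm_num) R) (hsub ξ hξ hb)


/-! ### Gauss–Green and the Sobolev inequality for sets of finite perimeter. -/

theorem divergence_smul_const {η : Euc d → ℝ} (hη : Differentiable ℝ η) (u x : Euc d) :
    divergence (fun y => η y • u) x = fderiv ℝ η x u := by
  have h1 : fderiv ℝ (fun y => η y • u) x = (fderiv ℝ η x).smulRight u :=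
    ((hη x).hasFDerivAt.smul_const u).fderiv
  have h2 : u = ∑ i, u i • EuclideanSpace.single i (1 : ℝ) := by
    have := (EuclideanSpace.basisFun (Fin d) ℝ).sum_repr u
    simpa using this.symm
  rw [divergence, h1]
  conv_rhs => rw [h2, map_sum]
  refine Finset.sum_congr rfl fun i _ => ?_
  simp [mul_comm]

namespace IsPerimeterPair

variable {Ω : Set (Euc d)} {μ : Measure (Euc d)} {ν : Euc d → Euc d}

theorem setIntegral_fderiv (h : IsPerimeterPair Ω μ ν) {η : Euc d → ℝ} (hη : ContDiff ℝ ∞ η)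
    (hc : HasCompactSupport η) (u : Euc d) :
    ∫ x in Ω, fderiv ℝ η x u = ∫ x, η x * ⟪u, ν x⟫ ∂μ := by
  have h1 := h.gauss_green (fun y => η y • u) (hη.smul contDiff_const) hc.smul_right
  simp only [divergence_smul_const (hη.differentiable (by simp)), real_inner_smul_left] at h1
  exact h1

theorem integrable_mul_inner (h : IsPerimeterPair Ω μ ν) {η : Euc d → ℝ} (hη : Continuous η)
    (hc : HasCompactSupport η) (u : Euc d) : Integrable (fun x => η x * ⟪u, ν x⟫) μ := by
  have := h.locallyFinite
  refine (hη.integrable_of_hasCompactSupport hc).mul_bdd (c := ‖u‖) ?_ ?_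
  · exact (measurable_const.inner h.measurable).aestronglyMeasurable
  · filter_upwards [h.norm_eq_one] with x hx
    simpa [hx] using norm_inner_le_norm (𝕜 := ℝ) u (ν x)

/-- The derivative of a mollification of `χ 1_Ω` is bounded by mollifications of the measures
`χ ‖∂Ω‖` and `|∇ χ| 1_Ω`. -/
theorem enorm_fderiv_convolution_le (h : IsPerimeterPair Ω μ ν) (hΩ : MeasurableSet Ω)
    {χ ρ : Euc d → ℝ}
    (hχ : ContDiff ℝ ∞ χ) (hχc : HasCompactSupport χ) (hχ0 : ∀ x, 0 ≤ χ x)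
    (hρ : ContDiff ℝ ∞ ρ) (hρc : HasCompactSupport ρ) (hρ0 : ∀ x, 0 ≤ ρ x) (x : Euc d) :
    ‖fderiv ℝ (convolution (Ω.indicator χ) ρ (ContinuousLinearMap.lsmul ℝ ℝ) volume) x‖ₑ ≤
      (∫⁻ y in Ω, ‖fderiv ℝ χ y‖ₑ * ENNReal.ofReal (ρ (x - y))) +
        ∫⁻ y, ENNReal.ofReal (χ y) * ENNReal.ofReal (ρ (x - y)) ∂μ := by
  have := h.locallyFinite
  have hχd : Differentiable ℝ χ := hχ.differentiable (by simp)
  have hρd : Differentiable ℝ ρ := hρ.differentiable (by simp)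
  have hχ' : Continuous (fderiv ℝ χ) := hχ.continuous_fderiv (by simp)
  have hρ' : Continuous (fderiv ℝ ρ) := hρ.continuous_fderiv (by simp)
  have hρx : ContDiff ℝ ∞ fun y => ρ (x - y) := hρ.comp (contDiff_const.sub contDiff_id)
  have hI1 : Integrable (fun y => ‖fderiv ℝ χ y‖ * ρ (x - y)) :=
    (hχ'.norm.mul hρx.continuous).integrable_of_hasCompactSupport (hχc.fderiv ℝ).norm.mul_right
  have hI2 : Integrable (fun y => χ y * ρ (x - y)) μ :=
    (hχ.continuous.mul hρx.continuous).integrable_of_hasCompactSupport hχc.mul_right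
  have hloc : LocallyIntegrable (Ω.indicator χ) volume :=
    (hχ.continuous.integrable_of_hasCompactSupport hχc).locallyIntegrable.indicator hΩ
  rw [(hρc.hasFDerivAt_convolution_right (ContinuousLinearMap.lsmul ℝ ℝ) hloc
    (hρ.of_le (by simp)) x).fderiv]
  set T := (convolution (Ω.indicator χ) (fderiv ℝ ρ)
    (ContinuousLinearMap.precompR (Euc d) (ContinuousLinearMap.lsmul ℝ ℝ)) volume) x with hT
  set B := (∫ y in Ω, ‖fderiv ℝ χ y‖ * ρ (x - y)) + ∫ y, χ y * ρ (x - y) ∂μ with hB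
  have hTB : ‖T‖ ≤ B := by
    have hB1 : 0 ≤ ∫ y in Ω, ‖fderiv ℝ χ y‖ * ρ (x - y) :=
      integral_nonneg fun y => mul_nonneg (norm_nonneg _) (hρ0 _)
    have hB2 : 0 ≤ ∫ y, χ y * ρ (x - y) ∂μ := integral_nonneg fun y => mul_nonneg (hχ0 _) (hρ0 _)
    refine ContinuousLinearMap.opNorm_le_bound _ (add_nonneg hB1 hB2) fun u => ?_
    have h1 : T u = ∫ y in Ω, χ y * fderiv ℝ ρ (x - y) u := by
      rw [hT, convolution_precompR_apply _ hloc (hρc.fderiv ℝ) hρ', convolution_def,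
        ← integral_indicator hΩ]
      refine integral_congr_ae (Eventually.of_forall fun y => ?_)
      by_cases hy : y ∈ Ω <;> simp [hy]
    have hprod : ∀ y, fderiv ℝ (fun y => χ y * ρ (x - y)) y u =
        fderiv ℝ χ y u * ρ (x - y) - χ y * fderiv ℝ ρ (x - y) u := by
      intro y
      have h2 : HasFDerivAt (fun y => ρ (x - y))
          ((fderiv ℝ ρ (x - y)).comp (-ContinuousLinearMap.id ℝ (Euc d))) y := by
        refine (hρd (x - y)).hasFDerivAt.comp y ?_
        simpa using (hasFDerivAt_id y).const_sub x
      rw [HasFDerivAt.fderiv (f := fun y => χ y * ρ (x - y)) ((hχd y).hasFDerivAt.mul h2)]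
      simp
      ring
    -- Gauss–Green for the product moves the derivative from the mollifier onto `χ`, at the price of
    -- a boundary term.
    have hGG := h.setIntegral_fderiv (hχ.mul hρx) hχc.mul_right u
    simp only [hprod] at hGG
    have hJ1 : Integrable (fun y => fderiv ℝ χ y u * ρ (x - y)) :=
      ((hχ'.clm_apply continuous_const).mul hρx.continuous).integrable_of_hasCompactSupport
        ((hχc.fderiv_apply ℝ u).mul_right)
    have hJ2 : Integrable (fun y => χ y * fderiv ℝ ρ (x - y) u) :=
      (hχ.continuous.mul ((hρ'.comp (continuous_const.sub continuous_id)).clm_apply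
        continuous_const)).integrable_of_hasCompactSupport hχc.mul_right
    rw [integral_sub hJ1.integrableOn hJ2.integrableOn, ← h1] at hGG
    have h3 : T u = (∫ y in Ω, fderiv ℝ χ y u * ρ (x - y)) -
        ∫ y, χ y * ρ (x - y) * ⟪u, ν y⟫ ∂μ := by linarith
    rw [h3, add_mul, ← integral_mul_const, ← integral_mul_const]
    refine (norm_sub_le _ _).trans (add_le_add ?_ ?_)
    · refine norm_integral_le_of_norm_le (hI1.mul_const _).integrableOn
        (Eventually.of_forall fun y => ?_)
      rw [norm_mul, Real.norm_of_nonneg (hρ0 _)]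
      calc ‖fderiv ℝ χ y u‖ * ρ (x - y) ≤ (‖fderiv ℝ χ y‖ * ‖u‖) * ρ (x - y) :=
            mul_le_mul_of_nonneg_right (ContinuousLinearMap.le_opNorm _ _) (hρ0 _)
        _ = _ := by ring
    · refine norm_integral_le_of_norm_le (hI2.mul_const _) ?_
      filter_upwards [h.norm_eq_one] with y hy
      rw [norm_mul, Real.norm_of_nonneg (mul_nonneg (hχ0 _) (hρ0 _))]
      refine mul_le_mul_of_nonneg_left ?_ (mul_nonneg (hχ0 _) (hρ0 _))
      simpa [hy] using norm_inner_le_norm (𝕜 := ℝ) u (ν y)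
  have hBe : ENNReal.ofReal B = (∫⁻ y in Ω, ‖fderiv ℝ χ y‖ₑ * ENNReal.ofReal (ρ (x - y))) +
        ∫⁻ y, ENNReal.ofReal (χ y) * ENNReal.ofReal (ρ (x - y)) ∂μ := by
    rw [hB, ENNReal.ofReal_add (integral_nonneg fun y => mul_nonneg (norm_nonneg _) (hρ0 _))
      (integral_nonneg fun y => mul_nonneg (hχ0 _) (hρ0 _)),
      ofReal_integral_eq_lintegral_ofReal hI1.integrableOn
        (Eventually.of_forall fun y => mul_nonneg (norm_nonneg _) (hρ0 _)),
      ofReal_integral_eq_lintegral_ofReal hI2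
        (Eventually.of_forall fun y => mul_nonneg (hχ0 _) (hρ0 _))]
    simp only [ENNReal.ofReal_mul (norm_nonneg _), ENNReal.ofReal_mul (hχ0 _), ofReal_norm]
  rw [← hBe, ← ofReal_norm]
  exact ENNReal.ofReal_le_ofReal hTB

/-- The Gagliardo-Nirenberg-Sobolev inequality for the function of bounded variation `χ 1_Ω`. -/
theorem lintegral_rpow_le (h : IsPerimeterPair Ω μ ν) (hΩ : IsOpen Ω) {χ : Euc d → ℝ}
    (hχ : ContDiff ℝ ∞ χ) (hχc : HasCompactSupport χ) (hχ0 : ∀ x, 0 ≤ χ x) {p : ℝ}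
    (hp : Real.HolderConjugate (Module.finrank ℝ (Euc d)) p) :
    ∫⁻ x in Ω, ENNReal.ofReal (χ x) ^ p ≤
      lintegralPowLePowLIntegralFDerivConst (volume : Measure (Euc d)) p *
        ((∫⁻ x in Ω, ‖fderiv ℝ χ x‖ₑ) + ∫⁻ x, ENNReal.ofReal (χ x) ∂μ) ^ p := by
  have := h.locallyFinite
  let φ : ℕ → ContDiffBump (0 : Euc d) := fun n =>
    ⟨1 / ((n : ℝ) + 1) / 2, 1 / ((n : ℝ) + 1), by positivity, half_lt_self (by positivity)⟩
  have hφ : Tendsto (fun n => (φ n).rOut) atTop (𝓝 0) := tendsto_one_div_add_atTop_nhds_zero_nat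
  let f : ℕ → Euc d → ℝ := fun n =>
    convolution (Ω.indicator χ) ((φ n).normed volume) (ContinuousLinearMap.lsmul ℝ ℝ) volume
  have hloc : LocallyIntegrable (Ω.indicator χ) volume :=
    (hχ.continuous.integrable_of_hasCompactSupport hχc).locallyIntegrable.indicator hΩ.measurableSet
  have hfs : ∀ n, ContDiff ℝ 1 (f n) := fun n =>
    ((φ n).hasCompactSupport_normed.contDiff_convolution_right (n := 1) _ hloc
      (φ n).contDiff_normed)
  have hfc : ∀ n, HasCompactSupport (f n) := fun n =>
    HasCompactSupport.convolution _ (hχc.mono (by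
      intro x hx; simp only [Function.mem_support, ne_eq, indicator_apply_eq_zero,
        Classical.not_imp] at hx; exact hx.2)) (φ n).hasCompactSupport_normed
  -- Convergence is needed only on Ω, where the truncated function is continuous because Ω is open.
  -- Fatou's lemma then passes the Sobolev inequality to the limit.
  have hlim : ∀ x ∈ Ω, Tendsto (fun n => f n x) atTop (𝓝 (χ x)) := by
    intro x hx
    have h1 : ContinuousAt (Ω.indicator χ) x :=
      hχ.continuous.continuousAt.congr
        ((eventually_of_mem (hΩ.mem_nhds hx) fun y hy => (indicator_of_mem hy χ).symm))
    have h2 := ContDiffBump.convolution_tendsto_right (μ := volume) (φ := φ) (l := atTop)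
      (g := fun _ => Ω.indicator χ) (k := fun _ => x) (x₀ := x) (z₀ := Ω.indicator χ x) hφ
      (Eventually.of_forall fun _ => hloc.aestronglyMeasurable)
      (h1.tendsto.comp tendsto_snd) tendsto_const_nhds
    rw [indicator_of_mem hx] at h2
    refine h2.congr fun n => ?_
    rw [convolution_lsmul_swap]
    simp only [f, convolution_def, ContinuousLinearMap.lsmul_apply, smul_eq_mul, mul_comm]
  have hmass : ∀ n (y : Euc d), ∫⁻ x, ENNReal.ofReal ((φ n).normed volume (x - y)) = 1 := by
    intro n y
    rw [lintegral_sub_right_eq_self (fun x => ENNReal.ofReal ((φ n).normed volume x)) y,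
      ← ofReal_integral_eq_lintegral_ofReal (φ n).integrable_normed
        (Eventually.of_forall (φ n).nonneg_normed), (φ n).integral_normed, ENNReal.ofReal_one]
  set X := (∫⁻ x in Ω, ‖fderiv ℝ χ x‖ₑ) + ∫⁻ x, ENNReal.ofReal (χ x) ∂μ with hX
  have hgrad : ∀ n, ∫⁻ x, ‖fderiv ℝ (f n) x‖ₑ ≤ X := by
    intro n
    have hm : Measurable fun z : Euc d × Euc d =>
        ENNReal.ofReal ((φ n).normed volume (z.1 - z.2)) :=
      ENNReal.measurable_ofReal.comp ((φ n).continuous_normed.measurable.comp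
        (measurable_fst.sub measurable_snd))
    have hm1 : Measurable fun z : Euc d × Euc d =>
        ‖fderiv ℝ χ z.2‖ₑ * ENNReal.ofReal ((φ n).normed volume (z.1 - z.2)) :=
      ((hχ.continuous_fderiv (by simp)).enorm.measurable.comp measurable_snd).mul hm
    have hm2 : Measurable fun z : Euc d × Euc d =>
        ENNReal.ofReal (χ z.2) * ENNReal.ofReal ((φ n).normed volume (z.1 - z.2)) :=
      ((ENNReal.measurable_ofReal.comp hχ.continuous.measurable).comp measurable_snd).mul hm
    refine (lintegral_mono fun x => h.enorm_fderiv_convolution_le hΩ.measurableSet hχ hχc hχ0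
      (φ n).contDiff_normed (φ n).hasCompactSupport_normed (φ n).nonneg_normed x).trans ?_
    rw [lintegral_add_left hm1.lintegral_prod_right', hX]
    refine add_le_add (le_of_eq ?_) (le_of_eq ?_)
    · refine (lintegral_lintegral_swap hm1.aemeasurable).trans (lintegral_congr fun y => ?_)
      dsimp only
      rw [lintegral_const_mul' _ _ (by simp), hmass, mul_one]
    · refine (lintegral_lintegral_swap hm2.aemeasurable).trans (lintegral_congr fun y => ?_)
      rw [lintegral_const_mul' _ _ (by simp), hmass, mul_one]
  have hp0 : 0 ≤ p := hp.symm.nonneg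
  calc ∫⁻ x in Ω, ENNReal.ofReal (χ x) ^ p
      = ∫⁻ x in Ω, liminf (fun n => ‖f n x‖ₑ ^ p) atTop := by
        refine setLIntegral_congr_fun hΩ.measurableSet fun x hx => ?_
        have h1 := ((hlim x hx).enorm).ennrpow_const p
        rw [h1.liminf_eq, Real.enorm_of_nonneg (hχ0 x)]
    _ ≤ liminf (fun n => ∫⁻ x in Ω, ‖f n x‖ₑ ^ p) atTop :=
        lintegral_liminf_le fun n => ((hfs n).continuous.enorm.measurable).pow_const p
    _ ≤ liminf (fun _ => lintegralPowLePowLIntegralFDerivConst (volume : Measure (Euc d)) p *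
          X ^ p) (atTop : Filter ℕ) := by
        refine liminf_le_liminf (Eventually.of_forall fun n => ?_)
        refine (setLIntegral_le_lintegral _ _).trans
          ((lintegral_pow_le_pow_lintegral_fderiv volume (hfs n) (hfc n) hp).trans ?_)
        gcongr
        exact hgrad n
    _ = _ := liminf_const _

end IsPerimeterPair

/-! ### Radial cutoff functions. -/

theorem exists_abs_deriv_smoothTransition_le :
    ∃ C : ℝ, 0 < C ∧ ∀ x, |deriv Real.smoothTransition x| ≤ C := by
  have hc : Continuous (deriv Real.smoothTransition) :=
    (Real.smoothTransition.contDiff (n := 1)).continuous_deriv (by simp)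
  obtain ⟨C, hC⟩ := isCompact_Icc.exists_bound_of_continuousOn (s := Icc (0 : ℝ) 1) hc.continuousOn
  refine ⟨max C 1, by positivity, fun x => ?_⟩
  by_cases hx : x ∈ Icc (0 : ℝ) 1
  · exact (hC x hx).trans (le_max_left _ _)
  · have h0 : deriv Real.smoothTransition x = 0 := by
      rw [mem_Icc, not_and_or, not_le, not_le] at hx
      rcases hx with hx | hx
      · have : Real.smoothTransition =ᶠ[𝓝 x] fun _ => 0 :=
          (eventually_lt_nhds hx).mono fun y hy => Real.smoothTransition.zero_of_nonpos hy.le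
        rw [this.deriv_eq, deriv_const]
      · have : Real.smoothTransition =ᶠ[𝓝 x] fun _ => 1 :=
          (eventually_gt_nhds hx).mono fun y hy => Real.smoothTransition.one_of_one_le hy.le
        rw [this.deriv_eq, deriv_const]
    rw [h0, abs_zero]
    positivity

/-- A smooth radial cutoff function that is `1` on `B(ξ,r)` and vanishes outside `B(ξ,R)`. -/
noncomputable def cutoff (ξ : Euc d) (r R : ℝ) (x : Euc d) : ℝ :=
  Real.smoothTransition ((R ^ 2 - ‖x - ξ‖ ^ 2) / (R ^ 2 - r ^ 2))

section Cutoff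

variable {ξ : Euc d} {r R : ℝ}

theorem contDiff_cutoff : ContDiff ℝ ∞ (cutoff ξ r R) :=
  Real.smoothTransition.contDiff.comp
    ((contDiff_const.sub ((contDiff_id.sub contDiff_const).norm_sq ℝ)).div_const _)

theorem cutoff_nonneg (x : Euc d) : 0 ≤ cutoff ξ r R x := Real.smoothTransition.nonneg _

theorem cutoff_eq_one (hr : 0 ≤ r) (hrR : r < R) {x : Euc d} (hx : x ∈ Metric.ball ξ r) :
    cutoff ξ r R x = 1 := by
  rw [Metric.mem_ball, dist_eq_norm] at hx
  refine Real.smoothTransition.one_of_one_le ?_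
  have h1 : 0 < R ^ 2 - r ^ 2 := by nlinarith
  rw [le_div_iff₀ h1]
  nlinarith [norm_nonneg (x - ξ)]

theorem cutoff_eq_zero (hr : 0 ≤ r) (hrR : r < R) {x : Euc d} (hx : x ∉ Metric.ball ξ R) :
    cutoff ξ r R x = 0 := by
  rw [Metric.mem_ball, dist_eq_norm, not_lt] at hx
  refine Real.smoothTransition.zero_of_nonpos ?_
  have h1 : 0 < R ^ 2 - r ^ 2 := by nlinarith
  exact div_nonpos_of_nonpos_of_nonneg (by nlinarith) h1.le

theorem hasCompactSupport_cutoff (hr : 0 ≤ r) (hrR : r < R) :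
    HasCompactSupport (cutoff ξ r R) :=
  HasCompactSupport.intro (isCompact_closedBall ξ R) fun _ hx =>
    cutoff_eq_zero hr hrR fun h => hx (Metric.ball_subset_closedBall h)

theorem fderiv_cutoff_eq_zero (hr : 0 ≤ r) (hrR : r < R) {x : Euc d} (hx : x ∉ Metric.ball ξ R) :
    fderiv ℝ (cutoff ξ r R) x = 0 := by
  refine IsLocalMin.fderiv_eq_zero (Eventually.of_forall fun y => ?_)
  rw [cutoff_eq_zero hr hrR hx]
  exact cutoff_nonneg y

theorem norm_fderiv_cutoff_le {C : ℝ} (hC : ∀ x, |deriv Real.smoothTransition x| ≤ C)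
    (hr : 0 ≤ r) (hrR : r < R) (x : Euc d) :
    ‖fderiv ℝ (cutoff ξ r R) x‖ ≤ 2 * C / (R - r) := by
  have hC0 : 0 ≤ C := (abs_nonneg _).trans (hC 0)
  have hRr : 0 < R - r := sub_pos.2 hrR
  by_cases hx : x ∈ Metric.ball ξ R
  swap
  · rw [fderiv_cutoff_eq_zero hr hrR hx, norm_zero]; positivity
  rw [Metric.mem_ball, dist_eq_norm] at hx
  have h1 : 0 < R ^ 2 - r ^ 2 := by nlinarith
  refine ContinuousLinearMap.opNorm_le_bound _ (by positivity) fun u => ?_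
  have h2 : HasFDerivAt (fun y : Euc d => (R ^ 2 - ‖y - ξ‖ ^ 2) / (R ^ 2 - r ^ 2))
      ((R ^ 2 - r ^ 2)⁻¹ • (-(2 • (innerSL ℝ (x - ξ)).comp
        (ContinuousLinearMap.id ℝ (Euc d))) : Euc d →L[ℝ] ℝ)) x := by
    simp only [div_eq_mul_inv]
    exact ((((hasFDerivAt_id x).sub_const ξ).norm_sq).const_sub (R ^ 2)).mul_const _
  have h3 : HasDerivAt Real.smoothTransition
      (deriv Real.smoothTransition ((R ^ 2 - ‖x - ξ‖ ^ 2) / (R ^ 2 - r ^ 2)))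
      ((R ^ 2 - ‖x - ξ‖ ^ 2) / (R ^ 2 - r ^ 2)) :=
    ((Real.smoothTransition.contDiff (n := 1)).differentiable (by simp) _).hasDerivAt
  have h4 : HasFDerivAt (cutoff ξ r R) _ x := h3.comp_hasFDerivAt x h2
  rw [h4.fderiv]
  have h5 : |⟪x - ξ, u⟫| ≤ R * ‖u‖ :=
    (abs_real_inner_le_norm _ _).trans (mul_le_mul_of_nonneg_right hx.le (norm_nonneg _))
  have h6 := hC ((R ^ 2 - ‖x - ξ‖ ^ 2) / (R ^ 2 - r ^ 2))
  set D := deriv Real.smoothTransition ((R ^ 2 - ‖x - ξ‖ ^ 2) / (R ^ 2 - r ^ 2))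
  have h7 : (D • (R ^ 2 - r ^ 2)⁻¹ • (-(2 • (innerSL ℝ (x - ξ)).comp
        (ContinuousLinearMap.id ℝ (Euc d))) : Euc d →L[ℝ] ℝ)) u = -(D * ((R ^ 2 - r ^ 2)⁻¹ * (2 * ⟪x - ξ, u⟫))) := by
    simp [inner_sub_left]
  rw [h7, norm_neg, Real.norm_eq_abs, abs_mul, abs_mul, abs_mul, abs_of_pos (inv_pos.2 h1), abs_two]
  have h8 : (R ^ 2 - r ^ 2)⁻¹ * R ≤ (R - r)⁻¹ := by
    rw [inv_mul_le_iff₀ h1, ← div_eq_mul_inv, le_div_iff₀ hRr]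
    nlinarith
  calc |D| * ((R ^ 2 - r ^ 2)⁻¹ * (2 * |⟪x - ξ, u⟫|))
      ≤ C * ((R ^ 2 - r ^ 2)⁻¹ * (2 * (R * ‖u‖))) := by gcongr
    _ = 2 * C * ((R ^ 2 - r ^ 2)⁻¹ * R) * ‖u‖ := by ring
    _ ≤ 2 * C * (R - r)⁻¹ * ‖u‖ := by gcongr
    _ = _ := by rw [← div_eq_mul_inv]

/-- With the layer-cake formula, this carries estimates on all concentric balls over to integrals of
the cutoff. -/
theorem superlevel_cutoff_eq_ball (hr : 0 ≤ r) (hrR : r < R) {t : ℝ} (ht : 0 < t) :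
    ∃ ρ ≤ R, {x | t < cutoff ξ r R x} = Metric.ball ξ ρ := by
  let g : ℝ → ℝ := fun a => Real.smoothTransition ((R ^ 2 - a ^ 2) / (R ^ 2 - r ^ 2))
  have h1 : 0 < R ^ 2 - r ^ 2 := by nlinarith
  have hg : Continuous g := Real.smoothTransition.continuous.comp (by fun_prop)
  have hanti : ∀ a b, 0 ≤ a → a ≤ b → g b ≤ g a := fun a b ha hab => by
    refine Real.smoothTransition.monotone ?_
    gcongr
  let A : Set ℝ := {a | 0 ≤ a ∧ t < g a}
  have hA : ∀ a ∈ A, a ≤ R := by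
    rintro a ⟨ha, hta⟩
    by_contra! hlt
    have : g a = 0 := Real.smoothTransition.zero_of_nonpos
      (div_nonpos_of_nonpos_of_nonneg (by nlinarith) h1.le)
    linarith
  have hbdd : BddAbove A := ⟨R, hA⟩
  rcases A.eq_empty_or_nonempty with hE | hne
  · refine ⟨0, by linarith, ?_⟩
    rw [Metric.ball_zero]
    refine eq_empty_of_forall_notMem fun x hx => ?_
    have : ‖x - ξ‖ ∈ A := ⟨norm_nonneg _, hx⟩
    rw [hE] at this
    exact this
  · refine ⟨sSup A, csSup_le hne hA, Set.ext fun x => ?_⟩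
    rw [Metric.mem_ball, dist_eq_norm]
    constructor
    · intro hx
      have hx' : t < g ‖x - ξ‖ := hx
      obtain ⟨b, hb, hb'⟩ := ((hg.continuousAt.eventually (lt_mem_nhds hx')).filter_mono
        (nhdsWithin_le_nhds (s := Ioi ‖x - ξ‖))).and self_mem_nhdsWithin |>.exists
      have hb'' : ‖x - ξ‖ < b := hb'
      exact hb''.trans_le (le_csSup hbdd ⟨(norm_nonneg _).trans hb''.le, hb⟩)
    · intro hx
      obtain ⟨a, ha, hxa⟩ := exists_lt_of_lt_csSup hne hx
      exact ha.2.trans_le (hanti _ _ (norm_nonneg _) hxa.le)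

/-- Comparison of two measures on concentric balls passes to integrals of radial cutoffs. -/
theorem lintegral_cutoff_le_of_forall_ball_le {κ μ : Measure (Euc d)} {c : ℝ≥0∞} (hc : c ≠ ⊤)
    (hr : 0 ≤ r) (hrR : r < R)
    (h : ∀ ρ, 0 < ρ → ρ ≤ R → κ (Metric.ball ξ ρ) ≤ c * μ (Metric.ball ξ ρ)) :
    ∫⁻ x, ENNReal.ofReal (cutoff ξ r R x) ∂κ ≤ c * ∫⁻ x, ENNReal.ofReal (cutoff ξ r R x) ∂μ := by
  have hm : Measurable (cutoff ξ r R) := contDiff_cutoff.continuous.measurable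
  rw [lintegral_eq_lintegral_meas_lt κ (Eventually.of_forall cutoff_nonneg) hm.aemeasurable,
    lintegral_eq_lintegral_meas_lt μ (Eventually.of_forall cutoff_nonneg) hm.aemeasurable,
    ← lintegral_const_mul' _ _ hc]
  refine setLIntegral_mono' measurableSet_Ioi fun t ht => ?_
  obtain ⟨ρ, hρ, heq⟩ := superlevel_cutoff_eq_ball (ξ := ξ) hr hrR ht
  rw [heq]
  rcases le_or_gt ρ 0 with h0 | h0
  · simp [Metric.ball_eq_empty.2 h0]
  · exact h ρ h0 hρ

end Cutoff

/-! ### De Giorgi's iteration for lower volume bounds. -/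

/-- The De Giorgi iteration. -/
theorem exists_le_of_isoperimetric {n : ℕ} (hn : 0 < n) {A : ℝ} (hA : 0 < A) :
    ∃ θ : ℝ, 0 < θ ∧ ∀ (m : ℝ → ℝ) (R₀ : ℝ), (∀ r, 0 < r → 0 < m r) → Monotone m →
      (∀ r R, 0 < r → r < R → R < R₀ → m r ^ n ≤ (A * (m R / (R - r))) ^ (n + 1)) →
      ∀ r, 0 < r → r < R₀ → θ * r ^ (n + 1) ≤ m r := by
  -- The value for which decay by the factor 2^(n+1) per step reproduces itself exactly: (4A)^(n+1)
  -- θ = 2^(-(n+1)n).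
  set θ : ℝ := ((2 : ℝ) ^ ((n + 1) * n))⁻¹ / (4 * A) ^ (n + 1) with hθ
  have hθ0 : 0 < θ := by positivity
  refine ⟨θ, hθ0, fun m R₀ hpos hmono hiso r hr hrR => ?_⟩
  by_contra! hlt
  -- Along radii shrinking to r/2 the masses tend to zero, which forces `m (r / 2) ≤ 0`.
  have key : ∀ k : ℕ, m (r / 2 + r / 2 / 2 ^ k) ≤ θ * r ^ (n + 1) / (2 ^ (n + 1)) ^ k := by
    intro k
    induction k with
    | zero => simpa using hlt.le
    | succ k ih =>
      set a := r / 2 + r / 2 / 2 ^ (k + 1) with ha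
      set b := r / 2 + r / 2 / 2 ^ k with hb
      have hab : b - a = r / (4 * 2 ^ k) := by rw [ha, hb, pow_succ]; field_simp; ring
      have ha0 : 0 < a := by positivity
      have hbr : b ≤ r := by
        have : r / 2 / 2 ^ k ≤ r / 2 := div_le_self (by positivity) (one_le_pow₀ (by norm_num))
        rw [hb]; linarith
      have hlt' : a < b := by
        have : 0 < b - a := by rw [hab]; positivity
        linarith
      have h1 := hiso a b ha0 hlt' (hbr.trans_lt hrR)
      rw [hab] at h1
      have hmb := (hpos b (by positivity)).le
      refine le_of_pow_le_pow_left₀ hn.ne' (by positivity) (h1.trans ?_)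
      calc (A * (m b / (r / (4 * 2 ^ k)))) ^ (n + 1)
          ≤ (A * (θ * r ^ (n + 1) / (2 ^ (n + 1)) ^ k / (r / (4 * 2 ^ k)))) ^ (n + 1) := by
            gcongr
        _ = (4 * A) ^ (n + 1) * θ ^ (n + 1) * ((r ^ n) ^ (n + 1) / (2 ^ k) ^ (n * (n + 1))) := by
            rw [← mul_pow, pow_mul (2 ^ k) n, ← div_pow, ← mul_pow]
            congr 1
            rw [pow_succ r, ← pow_mul 2 (n + 1) k, mul_comm (n + 1) k, pow_mul 2 k,
              pow_succ (2 ^ k : ℝ)]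
            field_simp
        _ = (θ * r ^ (n + 1) / (2 ^ (n + 1)) ^ (k + 1)) ^ n := by
            have h2 : (4 * A) ^ (n + 1) * θ = ((2 : ℝ) ^ ((n + 1) * n))⁻¹ := by
              rw [hθ]; field_simp
            clear_value θ
            rw [pow_succ' θ, ← mul_assoc, h2]
            rw [div_pow, mul_pow, ← pow_mul r, ← pow_mul r, ← pow_mul 2 k, ← pow_mul 2 (n + 1),
              ← pow_mul 2 _ n, mul_comm n (n + 1)]
            rw [show (n + 1) * (k + 1) * n = (n + 1) * n + k * ((n + 1) * n) by ring, pow_add]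
            field_simp
  have hlim : Tendsto (fun k : ℕ => θ * r ^ (n + 1) / (2 ^ (n + 1)) ^ k) atTop (𝓝 0) :=
    tendsto_const_nhds.div_atTop (tendsto_pow_atTop_atTop_of_one_lt
      (one_lt_pow₀ (by norm_num) (by omega)))
  have h0 : m (r / 2) ≤ 0 := ge_of_tendsto hlim (Eventually.of_forall fun k =>
    (hmono (by have : 0 ≤ r / 2 / 2 ^ k := by positivity
               linarith)).trans (key k))
  exact absurd (hpos (r / 2) (by positivity)) (not_lt.2 h0)


/-! ### Excess, perimeter bound and isoperimetric estimate. -/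

namespace IsPerimeterPair

variable {Ω : Set (Euc d)} {μ : Measure (Euc d)} {ν : Euc d → Euc d} {ξ n : Euc d}

theorem integrableOn_normal (h : IsPerimeterPair Ω μ ν) (r : ℝ) :
    IntegrableOn ν (Metric.ball ξ r) μ := by
  have := h.locallyFinite
  exact IntegrableOn.of_bound measure_ball_lt_top h.measurable.aestronglyMeasurable 1
    (ae_restrict_of_ae (h.norm_eq_one.mono fun x hx => hx.le))

theorem integrableOn_one_sub_inner (h : IsPerimeterPair Ω μ ν) (r : ℝ) :
    IntegrableOn (fun y => 1 - ⟪ν y, n⟫) (Metric.ball ξ r) μ := by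
  have := h.locallyFinite
  exact (integrableOn_const (hs := measure_ball_lt_top.ne)).sub ((h.integrableOn_normal r).inner_const n)

theorem one_sub_inner_nonneg (h : IsPerimeterPair Ω μ ν) (hn : ‖n‖ = 1) :
    ∀ᵐ y ∂μ, 0 ≤ 1 - ⟪ν y, n⟫ := by
  filter_upwards [h.norm_eq_one] with y hy
  have := real_inner_le_norm (ν y) n
  rw [hy, hn, one_mul] at this
  linarith

/-- The integrand is |ν - n|²/2 almost everywhere, so this is smallness of the excess: the averages
of ⟪ν,n⟫ tend to |n|² = 1. -/
theorem exists_setIntegral_one_sub_inner_le (h : IsPerimeterPair Ω μ ν)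
    (hpos : ∀ r : ℝ, 0 < r → 0 < μ (Metric.ball ξ r)) (hn : ‖n‖ = 1)
    (hlim : Tendsto (fun r : ℝ => ⨍ y in Metric.ball ξ r, ν y ∂μ) (𝓝[>] 0) (𝓝 n))
    {δ : ℝ} (hδ : 0 < δ) :
    ∃ R : ℝ, 0 < R ∧ ∀ r, 0 < r → r < R →
      ∫ y in Metric.ball ξ r, (1 - ⟪ν y, n⟫) ∂μ ≤ δ * μ.real (Metric.ball ξ r) := by
  have := h.locallyFinite
  have h1 : Tendsto (fun r : ℝ => ⟪⨍ y in Metric.ball ξ r, ν y ∂μ, n⟫) (𝓝[>] 0) (𝓝 1) := by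
    have := Filter.Tendsto.inner (𝕜 := ℝ) hlim (tendsto_const_nhds (x := n))
    rwa [real_inner_self_eq_norm_sq, hn, one_pow] at this
  obtain ⟨R, hR, hlt⟩ := (mem_nhdsGT_iff_exists_Ioo_subset).1
    (h1.eventually (lt_mem_nhds (show 1 - δ < 1 by linarith)))
  refine ⟨R, hR, fun r hr hrR => ?_⟩
  have h2 : 1 - δ < ⟪⨍ y in Metric.ball ξ r, ν y ∂μ, n⟫ := hlt ⟨hr, hrR⟩
  have hM : 0 < μ.real (Metric.ball ξ r) :=
    ENNReal.toReal_pos (hpos r hr).ne' measure_ball_lt_top.ne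
  have h3 : ∫ y in Metric.ball ξ r, ⟪ν y, n⟫ ∂μ = ⟪∫ y in Metric.ball ξ r, ν y ∂μ, n⟫ :=
    (integral_congr_ae (Eventually.of_forall fun y => real_inner_comm _ _)).trans
      ((integral_inner (h.integrableOn_normal r) n).trans (real_inner_comm _ _))
  have hconst : Integrable (fun _ => (1 : ℝ)) (μ.restrict (Metric.ball ξ r)) :=
    integrableOn_const (hs := measure_ball_lt_top.ne)
  rw [integral_sub hconst
    ((h.integrableOn_normal r).inner_const n), h3, setIntegral_const, smul_eq_mul, mul_one]
  rw [setAverage_eq, real_inner_smul_left, ← div_eq_inv_mul, lt_div_iff₀ hM] at h2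
  linarith

theorem setIntegral_eq_setIntegral_inter_ball {R : ℝ} (f : Euc d → ℝ)
    (hf : ∀ x ∉ Metric.ball ξ R, f x = 0) (hΩ : MeasurableSet Ω) :
    ∫ x in Ω, f x = ∫ x in Ω ∩ Metric.ball ξ R, f x :=
  setIntegral_eq_of_subset_of_forall_sdiff_eq_zero hΩ inter_subset_left
    fun x hx => hf x fun hB => hx.2 ⟨hx.1, hB⟩

/-- Since the excess is at most half the mass, the integral of the cutoff is at most twice that of
the cutoff times ⟪ν,n⟫. Gauss–Green turns the latter into the integral over Ω of the derivative of
the cutoff along n. -/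
theorem integral_cutoff_le (h : IsPerimeterPair Ω μ ν) (hΩ : MeasurableSet Ω) (hn : ‖n‖ = 1)
    {C : ℝ} (hC : ∀ x, |deriv Real.smoothTransition x| ≤ C) {r R : ℝ} (hr : 0 ≤ r) (hrR : r < R)
    (H : ∀ ρ, 0 < ρ → ρ ≤ R →
      ∫ y in Metric.ball ξ ρ, (1 - ⟪ν y, n⟫) ∂μ ≤ 1 / 2 * μ.real (Metric.ball ξ ρ)) :
    ∫ x, cutoff ξ r R x ∂μ ≤ 2 * (2 * C / (R - r) * volume.real (Ω ∩ Metric.ball ξ R)) := by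
  have := h.locallyFinite
  have hcont : Continuous (cutoff ξ r R) := contDiff_cutoff.continuous
  have hcs := hasCompactSupport_cutoff (ξ := ξ) hr hrR
  have hm : Measurable fun y => ENNReal.ofReal (1 - ⟪ν y, n⟫) :=
    (measurable_const.sub (h.measurable.inner measurable_const)).ennreal_ofReal
  have hχm : Measurable fun y => ENNReal.ofReal (cutoff ξ r R y) := hcont.measurable.ennreal_ofReal
  have h1 := lintegral_cutoff_le_of_forall_ball_le (ξ := ξ) (μ := μ)
    (κ := μ.withDensity fun y => ENNReal.ofReal (1 - ⟪ν y, n⟫))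
    (c := ENNReal.ofReal (1 / 2)) ENNReal.ofReal_ne_top hr hrR fun ρ hρ hρR => by
      rw [withDensity_apply _ measurableSet_ball, ← ofReal_integral_eq_lintegral_ofReal
        (h.integrableOn_one_sub_inner ρ) (ae_restrict_of_ae (h.one_sub_inner_nonneg hn)),
        ← ofReal_measureReal measure_ball_lt_top.ne, ← ENNReal.ofReal_mul (by norm_num)]
      exact ENNReal.ofReal_le_ofReal (H ρ hρ hρR)
  rw [lintegral_withDensity_eq_lintegral_mul _ hm hχm] at h1
  have hI : Integrable (cutoff ξ r R) μ := hcont.integrable_of_hasCompactSupport hcs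
  have hI2 : Integrable (fun y => cutoff ξ r R y * ⟪n, ν y⟫) μ := h.integrable_mul_inner hcont hcs n
  have h2 : ∫ y, (cutoff ξ r R y - cutoff ξ r R y * ⟪n, ν y⟫) ∂μ ≤
      1 / 2 * ∫ y, cutoff ξ r R y ∂μ := by
    have hI3 : Integrable (fun y => cutoff ξ r R y - cutoff ξ r R y * ⟪n, ν y⟫) μ := hI.sub hI2
    refine (ENNReal.ofReal_le_ofReal_iff (mul_nonneg (by norm_num)
      (integral_nonneg cutoff_nonneg))).1 ?_
    rw [ofReal_integral_eq_lintegral_ofReal hI3, ENNReal.ofReal_mul (by norm_num),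
      ofReal_integral_eq_lintegral_ofReal hI (Eventually.of_forall cutoff_nonneg)]
    · refine le_trans (le_of_eq (lintegral_congr_ae ?_)) h1
      filter_upwards [h.one_sub_inner_nonneg hn] with y hy
      rw [Pi.mul_apply, ← ENNReal.ofReal_mul hy, real_inner_comm]
      congr 1; ring
    · filter_upwards [h.one_sub_inner_nonneg hn] with y hy
      rw [Pi.zero_apply, real_inner_comm]
      nlinarith [cutoff_nonneg (ξ := ξ) (r := r) (R := R) y]
  rw [integral_sub hI hI2, ← h.setIntegral_fderiv contDiff_cutoff hcs n,
    setIntegral_eq_setIntegral_inter_ball (ξ := ξ) _ (fun x hx => by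
      rw [fderiv_cutoff_eq_zero hr hrR hx, zero_apply]) hΩ] at h2
  have h3 := norm_setIntegral_le_of_norm_le_const (μ := volume) (s := Ω ∩ Metric.ball ξ R)
    (f := fun x => fderiv ℝ (cutoff ξ r R) x n) (C := 2 * C / (R - r))
    ((measure_mono inter_subset_right).trans_lt measure_ball_lt_top) fun x _ => by
      have := (fderiv ℝ (cutoff ξ r R) x).le_opNorm n
      rw [hn, mul_one] at this
      exact this.trans (norm_fderiv_cutoff_le hC hr hrR x)
  have h4 := (le_abs_self _).trans h3
  linarith

/-- The isoperimetric estimate between concentric balls. -/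
theorem exists_isoperimetric (hd : 2 ≤ d) : ∃ A : ℝ, 0 < A ∧
    ∀ {Ω : Set (Euc d)} {μ : Measure (Euc d)} {ν : Euc d → Euc d} {ξ n : Euc d},
    IsPerimeterPair Ω μ ν → IsOpen Ω → ‖n‖ = 1 → ∀ {r R : ℝ}, 0 < r → r < R →
    (∀ ρ, 0 < ρ → ρ ≤ R →
      ∫ y in Metric.ball ξ ρ, (1 - ⟪ν y, n⟫) ∂μ ≤ 1 / 2 * μ.real (Metric.ball ξ ρ)) →
    volume.real (Ω ∩ Metric.ball ξ r) ^ (d - 1) ≤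
      (A * (volume.real (Ω ∩ Metric.ball ξ R) / (R - r))) ^ (d - 1 + 1) := by
  obtain ⟨C, hC0, hC⟩ := exists_abs_deriv_smoothTransition_le
  set p : ℝ := Real.conjExponent d with hpdef
  have hd1 : (1 : ℝ) < d := by exact_mod_cast (by omega : 1 < d)
  have hp : Real.HolderConjugate (Module.finrank ℝ (Euc d)) p := by
    rw [finrank_euclideanSpace_fin]
    exact Real.HolderConjugate.conjExponent hd1
  set K : ℝ≥0 := lintegralPowLePowLIntegralFDerivConst (volume : Measure (Euc d)) p with hK
  -- The gradient term contributes 2C and the perimeter term 4C. `K + 1 ≥ 1` absorbs the mismatch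
  -- between the exponents d - 1 and d.
  refine ⟨(K + 1) * (6 * C), by positivity, ?_⟩
  intro Ω μ ν ξ n h hΩ hn r R hr hrR H
  have := h.locallyFinite
  have hcont : Continuous (cutoff ξ r R) := contDiff_cutoff.continuous
  have hcs := hasCompactSupport_cutoff (ξ := ξ) hr.le hrR
  have hRr : 0 < R - r := sub_pos.2 hrR
  have hfin : ∀ t, volume (Ω ∩ Metric.ball ξ t) ≠ ⊤ := fun t =>
    ((measure_mono inter_subset_right).trans_lt measure_ball_lt_top).ne
  set M := volume.real (Ω ∩ Metric.ball ξ R) with hM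
  set Y := 6 * C * (M / (R - r)) with hY
  have hY0 : 0 ≤ Y := by positivity
  have h1 := h.lintegral_rpow_le hΩ contDiff_cutoff hcs cutoff_nonneg hp
  have h2 : (∫⁻ x in Ω, ‖fderiv ℝ (cutoff ξ r R) x‖ₑ) ≤ ENNReal.ofReal (2 * C / (R - r) * M) := by
    rw [ENNReal.ofReal_mul (by positivity), hM, ofReal_measureReal (hfin R), ← setLIntegral_const,
      ← lintegral_indicator hΩ.measurableSet,
      ← lintegral_indicator (hΩ.inter Metric.isOpen_ball).measurableSet]
    refine lintegral_mono fun x => ?_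
    by_cases hx : x ∈ Ω ∩ Metric.ball ξ R
    · rw [indicator_of_mem hx, indicator_of_mem hx.1, ← ofReal_norm]
      exact ENNReal.ofReal_le_ofReal (norm_fderiv_cutoff_le hC hr.le hrR x)
    · rw [indicator_of_notMem hx]
      by_cases hxΩ : x ∈ Ω
      · rw [indicator_of_mem hxΩ, fderiv_cutoff_eq_zero hr.le hrR fun hB => hx ⟨hxΩ, hB⟩,
          ← ofReal_norm, norm_zero, ENNReal.ofReal_zero]
      · rw [indicator_of_notMem hxΩ]
  have h3 : (∫⁻ x, ENNReal.ofReal (cutoff ξ r R x) ∂μ) ≤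
      ENNReal.ofReal (2 * (2 * C / (R - r) * M)) := by
    rw [← ofReal_integral_eq_lintegral_ofReal (hcont.integrable_of_hasCompactSupport hcs)
      (Eventually.of_forall cutoff_nonneg)]
    exact ENNReal.ofReal_le_ofReal (h.integral_cutoff_le hΩ.measurableSet hn hC hr.le hrR H)
  have h4 : (∫⁻ x in Ω, ‖fderiv ℝ (cutoff ξ r R) x‖ₑ) +
      ∫⁻ x, ENNReal.ofReal (cutoff ξ r R x) ∂μ ≤ ENNReal.ofReal Y := by
    refine (add_le_add h2 h3).trans ?_
    rw [← ENNReal.ofReal_add (by positivity) (by positivity)]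
    refine ENNReal.ofReal_le_ofReal (le_of_eq ?_)
    rw [hY]; ring
  have hp0 : 0 ≤ p := hp.symm.nonneg
  have h5 : volume (Ω ∩ Metric.ball ξ r) ≤ ∫⁻ x in Ω, ENNReal.ofReal (cutoff ξ r R x) ^ p := by
    rw [← setLIntegral_one]
    refine le_trans (le_of_eq ?_) 
      (lintegral_mono_set (inter_subset_left (t := Metric.ball ξ r)))
    refine setLIntegral_congr_fun (hΩ.inter Metric.isOpen_ball).measurableSet fun x hx => ?_
    rw [cutoff_eq_one hr.le hrR hx.2, ENNReal.ofReal_one, ENNReal.one_rpow]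
  have h6 : volume (Ω ∩ Metric.ball ξ r) ≤ ENNReal.ofReal (K * Y ^ p) := by
    refine h5.trans (h1.trans ?_)
    rw [ENNReal.ofReal_mul (NNReal.coe_nonneg K), ENNReal.ofReal_coe_nnreal, ← ENNReal.ofReal_rpow_of_nonneg hY0 hp0]
    gcongr
  have h7 : volume.real (Ω ∩ Metric.ball ξ r) ≤ K * Y ^ p :=
    ENNReal.toReal_le_of_le_ofReal (by positivity) h6
  have hdn : ((d - 1 : ℕ) : ℝ) = d - 1 := by rw [Nat.cast_sub (by omega), Nat.cast_one]
  have h8 : (Y ^ p) ^ (d - 1) = Y ^ (d - 1 + 1) := by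
    rw [← Real.rpow_natCast, ← Real.rpow_mul hY0, ← Real.rpow_natCast]
    congr 1
    rw [hpdef, Real.conjExponent, hdn, Nat.sub_add_cancel (by omega)]
    have : (d : ℝ) - 1 ≠ 0 := by linarith
    field_simp
  calc volume.real (Ω ∩ Metric.ball ξ r) ^ (d - 1) ≤ (K * Y ^ p) ^ (d - 1) := by gcongr
    _ = (K : ℝ) ^ (d - 1) * Y ^ (d - 1 + 1) := by rw [mul_pow, h8]
    _ ≤ ((K : ℝ) + 1) ^ (d - 1 + 1) * Y ^ (d - 1 + 1) := by
        gcongr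
        calc (K : ℝ) ^ (d - 1) ≤ (K + 1) ^ (d - 1) := by gcongr; linarith
          _ ≤ (K + 1) ^ (d - 1 + 1) := pow_le_pow_right₀ (by linarith [K.2]) (by omega)
    _ = _ := by rw [← mul_pow, hY]; congr 1; ring

end IsPerimeterPair


/-! ### Sets confined to a thin cone near a reduced boundary point. -/

theorem hasDerivAt_expNegInvGlue {a : ℝ} (ha : 0 < a) :
    HasDerivAt expNegInvGlue (Real.exp (-a⁻¹) * (a ^ 2)⁻¹) a := by
  have h1 : HasDerivAt (fun x : ℝ => Real.exp (-x⁻¹)) (Real.exp (-a⁻¹) * (a ^ 2)⁻¹) a := by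
    have := ((hasDerivAt_inv ha.ne').neg).exp
    simpa using this
  refine h1.congr_of_eventuallyEq ((eventually_gt_nhds ha).mono fun x hx => ?_)
  simp [expNegInvGlue, hx.not_ge]

/-- A smooth radial bump function supported in `closedBall c (2 * h)`. -/
noncomputable def tiltBump (c : Euc d) (h : ℝ) (x : Euc d) : ℝ :=
  expNegInvGlue ((4 * h ^ 2 - ‖x - c‖ ^ 2) / h ^ 2)

section TiltBump

variable {c : Euc d} {h : ℝ}

theorem contDiff_tiltBump : ContDiff ℝ ∞ (tiltBump c h) :=
  expNegInvGlue.contDiff.comp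
    ((contDiff_const.sub ((contDiff_id.sub contDiff_const).norm_sq ℝ)).div_const _)

theorem tiltBump_nonneg (x : Euc d) : 0 ≤ tiltBump c h x := expNegInvGlue.nonneg _

theorem tiltBump_le_one (x : Euc d) : tiltBump c h x ≤ 1 := by
  unfold tiltBump expNegInvGlue
  split_ifs with h0
  · exact zero_le_one
  · rw [Real.exp_le_one_iff, neg_nonpos, inv_nonneg]
    exact (not_le.1 h0).le

theorem tiltBump_eq_zero (hh : 0 < h) {x : Euc d} (hx : x ∉ Metric.ball c (2 * h)) :
    tiltBump c h x = 0 := by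
  rw [Metric.mem_ball, dist_eq_norm, not_lt] at hx
  exact expNegInvGlue.zero_of_nonpos
    (div_nonpos_of_nonpos_of_nonneg (by nlinarith) (by positivity))

theorem hasCompactSupport_tiltBump (hh : 0 < h) : HasCompactSupport (tiltBump c h) :=
  HasCompactSupport.intro (isCompact_closedBall c (2 * h)) fun _ hx =>
    tiltBump_eq_zero hh fun h' => hx (Metric.ball_subset_closedBall h')

theorem fderiv_tiltBump_apply (hh : 0 < h) {x : Euc d} (hx : x ∈ Metric.ball c (2 * h))
    (u : Euc d) :
    fderiv ℝ (tiltBump c h) x u = Real.exp (-((4 * h ^ 2 - ‖x - c‖ ^ 2) / h ^ 2)⁻¹) *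
      (((4 * h ^ 2 - ‖x - c‖ ^ 2) / h ^ 2) ^ 2)⁻¹ * (-(2 * ⟪x - c, u⟫) / h ^ 2) := by
  rw [Metric.mem_ball, dist_eq_norm] at hx
  have ha : 0 < (4 * h ^ 2 - ‖x - c‖ ^ 2) / h ^ 2 :=
    div_pos (by nlinarith [norm_nonneg (x - c)]) (by positivity)
  have h2 : HasFDerivAt (fun y : Euc d => (4 * h ^ 2 - ‖y - c‖ ^ 2) / h ^ 2)
      ((h ^ 2)⁻¹ • (-(2 • (innerSL ℝ (x - c)).comp
        (ContinuousLinearMap.id ℝ (Euc d))) : Euc d →L[ℝ] ℝ)) x := by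
    simp only [div_eq_mul_inv]
    exact ((((hasFDerivAt_id x).sub_const c).norm_sq).const_sub (4 * h ^ 2)).mul_const _
  have h4 : HasFDerivAt (tiltBump c h) _ x :=
    (hasDerivAt_expNegInvGlue ha).comp_hasFDerivAt x h2
  rw [h4.fderiv]
  simp only [smul_apply, neg_apply,
    ContinuousLinearMap.comp_id, innerSL_apply_apply, smul_eq_mul, nsmul_eq_mul, Nat.cast_ofNat]
  ring

theorem fderiv_tiltBump_nonneg (hh : 0 < h) {x u : Euc d}
    (hx : x ∈ Metric.ball c (2 * h) → ⟪x - c, u⟫ ≤ 0) : 0 ≤ fderiv ℝ (tiltBump c h) x u := by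
  by_cases hB : x ∈ Metric.ball c (2 * h)
  · rw [fderiv_tiltBump_apply hh hB]
    have := hx hB
    have h1 : 0 ≤ -(2 * ⟪x - c, u⟫) / h ^ 2 := div_nonneg (by linarith) (by positivity)
    positivity
  · have : fderiv ℝ (tiltBump c h) x = 0 := IsLocalMin.fderiv_eq_zero
      (Eventually.of_forall fun y => by
        rw [tiltBump_eq_zero hh hB]; exact tiltBump_nonneg y)
    rw [this, zero_apply]

/-- The argument of the glue function lies in [1,4] here, whence the factors e⁻¹ and 1/16. -/
theorem le_fderiv_tiltBump (hh : 0 < h) {x u : Euc d} (hx : ‖x - c‖ ^ 2 ≤ 3 * h ^ 2)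
    (hu : h / 2 ≤ -⟪x - c, u⟫) :
    Real.exp (-1) / 16 / h ≤ fderiv ℝ (tiltBump c h) x u := by
  have hB : x ∈ Metric.ball c (2 * h) := by
    rw [Metric.mem_ball, dist_eq_norm]; nlinarith [norm_nonneg (x - c)]
  rw [fderiv_tiltBump_apply hh hB]
  set a := (4 * h ^ 2 - ‖x - c‖ ^ 2) / h ^ 2 with ha
  have h2 : 0 < h ^ 2 := by positivity
  have ha1 : 1 ≤ a := by rw [ha, le_div_iff₀ h2]; linarith
  have ha4 : a ≤ 4 := by rw [ha, div_le_iff₀ h2]; nlinarith [sq_nonneg ‖x - c‖]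
  have e1 : Real.exp (-1) ≤ Real.exp (-a⁻¹) := by
    rw [Real.exp_le_exp, neg_le_neg_iff]; exact inv_le_one_of_one_le₀ ha1
  have e2 : (16 : ℝ)⁻¹ ≤ (a ^ 2)⁻¹ := by
    apply inv_anti₀ (by positivity); nlinarith
  have e3 : h⁻¹ ≤ -(2 * ⟪x - c, u⟫) / h ^ 2 := by
    rw [le_div_iff₀ h2, inv_mul_eq_div, pow_two, mul_div_assoc, div_self hh.ne']; linarith
  rw [div_eq_mul_inv, div_eq_mul_inv]
  gcongr

end TiltBump

namespace IsPerimeterPair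

variable {Ω : Set (Euc d)} {μ : Measure (Euc d)} {ν : Euc d → Euc d} {ξ n e : Euc d}

/-- If `Ω` lies near `ξ` in a thin cone around a hyperplane, then the volume of `Ω` near `ξ` is
controlled by the excess of the perimeter measure. -/
theorem volume_inter_ball_le (hP : IsPerimeterPair Ω μ ν) (hΩ : MeasurableSet Ω) (hn : ‖n‖ = 1)
    (he : ‖e‖ = 1) (hen : ⟪e, n⟫ ≤ 0) {h δ : ℝ} (hh : 0 < h) (hδ : 0 < δ)
    (hcone : ∀ x ∈ Ω ∩ Metric.ball ξ (3 * h), |⟪e, x - ξ⟫| ≤ 1 / 3 * ‖x - ξ‖)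
    (H : ∫ y in Metric.ball ξ (3 * h), (1 - ⟪ν y, n⟫) ∂μ ≤
      δ ^ 2 * μ.real (Metric.ball ξ (3 * h))) :
    Real.exp (-1) / 16 / h * volume.real (Ω ∩ Metric.ball ξ (h / 4)) ≤
      3 / 2 * δ * μ.real (Metric.ball ξ (3 * h)) := by
  have := hP.locallyFinite
  set c := ξ + h • e with hc
  have hcξ : ∀ x, x - c = (x - ξ) - h • e := fun x => by rw [hc]; abel
  have hhe : ‖h • e‖ = h := by rw [norm_smul, he, mul_one, Real.norm_of_nonneg hh.le]
  have hinner : ∀ x, ⟪x - c, e⟫ = ⟪e, x - ξ⟫ - h := fun x => by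
    rw [hcξ, inner_sub_left, real_inner_smul_left, real_inner_self_eq_norm_sq, he, real_inner_comm]
    ring
  have hball : Metric.ball c (2 * h) ⊆ Metric.ball ξ (3 * h) := by
    refine Metric.ball_subset_ball' ?_
    rw [hc, dist_eq_norm, add_sub_cancel_left, hhe]; linarith
  have hcs := hasCompactSupport_tiltBump (c := c) hh
  have hcont : Continuous (tiltBump c h) := contDiff_tiltBump.continuous
  have hGG := hP.setIntegral_fderiv contDiff_tiltBump hcs e
  have hIf : Integrable (fun x => fderiv ℝ (tiltBump c h) x e) :=
    (((contDiff_tiltBump (c := c) (h := h)).continuous_fderiv (by simp)).clm_apply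
      continuous_const).integrable_of_hasCompactSupport (hcs.fderiv_apply ℝ e)
  -- In the thin cone ⟪e, x - ξ⟫ is at most (1/3)(3h) = h, the height of the centre `c`. So Ω lies
  -- below the centre, where the bump increases along `e`.
  have hnonneg : ∀ x ∈ Ω, 0 ≤ fderiv ℝ (tiltBump c h) x e := fun x hx =>
    fderiv_tiltBump_nonneg hh fun hxB => by
      have h1 := hcone x ⟨hx, hball hxB⟩
      have h2 := hball hxB
      rw [Metric.mem_ball, dist_eq_norm] at h2
      rw [hinner]
      linarith [le_abs_self ⟪e, x - ξ⟫]
  have hfin : volume (Ω ∩ Metric.ball ξ (h / 4)) ≠ ⊤ :=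
    ((measure_mono inter_subset_right).trans_lt measure_ball_lt_top).ne
  have hlow : Real.exp (-1) / 16 / h * volume.real (Ω ∩ Metric.ball ξ (h / 4)) ≤
      ∫ x in Ω, fderiv ℝ (tiltBump c h) x e := by
    refine le_trans ?_ (setIntegral_mono_set (s := Ω ∩ Metric.ball ξ (h / 4)) hIf.integrableOn
      ((ae_restrict_iff' hΩ).2 (Eventually.of_forall hnonneg))
      (Eventually.of_forall fun x hx => hx.1))
    refine setIntegral_ge_of_const_le_real (hΩ.inter measurableSet_ball) hfin (fun x hx => ?_)
      hIf.integrableOn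
    have h1 := hx.2
    rw [Metric.mem_ball, dist_eq_norm] at h1
    refine le_fderiv_tiltBump hh ?_ ?_
    · have h2 : ‖x - c‖ ≤ 5 / 4 * h := by
        rw [hcξ]; linarith [norm_sub_le (x - ξ) (h • e)]
      nlinarith [norm_nonneg (x - c)]
    · have h2 := real_inner_le_norm e (x - ξ)
      rw [he, one_mul] at h2
      rw [hinner]; linarith
  -- Since ⟪e,n⟫ ≤ 0, ⟪e,ν⟫ is at most |ν - n|. Young's inequality a ≤ δ/2 + a²/(2δ) then brings in
  -- the excess.
  have hup : ∫ x, tiltBump c h x * ⟪e, ν x⟫ ∂μ ≤ 3 / 2 * δ * μ.real (Metric.ball ξ (3 * h)) := by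
    rw [← setIntegral_eq_integral_of_forall_compl_eq_zero (s := Metric.ball ξ (3 * h))
      fun x hx => by rw [tiltBump_eq_zero hh fun hB => hx (hball hB), zero_mul]]
    have hconst : Integrable (fun _ => δ / 2) (μ.restrict (Metric.ball ξ (3 * h))) :=
      integrableOn_const (hs := measure_ball_lt_top.ne)
    have hI1 := hP.integrableOn_one_sub_inner (ξ := ξ) (n := n) (3 * h)
    have hI2 : Integrable (fun y => δ / 2 + δ⁻¹ * (1 - ⟪ν y, n⟫))
        (μ.restrict (Metric.ball ξ (3 * h))) := hconst.add (hI1.const_mul δ⁻¹)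
    calc ∫ x in Metric.ball ξ (3 * h), tiltBump c h x * ⟪e, ν x⟫ ∂μ
        ≤ ∫ y in Metric.ball ξ (3 * h), (δ / 2 + δ⁻¹ * (1 - ⟪ν y, n⟫)) ∂μ := by
          refine integral_mono_ae (hP.integrable_mul_inner hcont hcs e).integrableOn hI2
            (ae_restrict_of_ae ?_)
          filter_upwards [hP.norm_eq_one] with y hy
          have h1 : ⟪e, ν y⟫ ≤ ‖ν y - n‖ := by
            have h2 := real_inner_le_norm e (ν y - n)
            rw [inner_sub_right, he, one_mul] at h2
            linarith
          have h3 : ‖ν y - n‖ ^ 2 = 2 * (1 - ⟪ν y, n⟫) := by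
            rw [norm_sub_sq_real, hy, hn]; ring
          have h4 : ‖ν y - n‖ ≤ δ / 2 + δ⁻¹ * (1 - ⟪ν y, n⟫) := by
            have h5 : 1 - ⟪ν y, n⟫ = ‖ν y - n‖ ^ 2 / 2 := by linarith
            rw [h5]
            have h6 : δ / 2 + δ⁻¹ * (‖ν y - n‖ ^ 2 / 2) - ‖ν y - n‖ =
                δ⁻¹ / 2 * (‖ν y - n‖ - δ) ^ 2 := by field_simp; ring
            have h7 : 0 ≤ δ⁻¹ / 2 * (‖ν y - n‖ - δ) ^ 2 := by positivity
            linarith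
          calc tiltBump c h y * ⟪e, ν y⟫ ≤ tiltBump c h y * ‖ν y - n‖ :=
                mul_le_mul_of_nonneg_left h1 (tiltBump_nonneg y)
            _ ≤ 1 * ‖ν y - n‖ := mul_le_mul_of_nonneg_right (tiltBump_le_one y) (norm_nonneg _)
            _ ≤ _ := by rw [one_mul]; exact h4
      _ = δ / 2 * μ.real (Metric.ball ξ (3 * h)) +
          δ⁻¹ * ∫ y in Metric.ball ξ (3 * h), (1 - ⟪ν y, n⟫) ∂μ := by
          rw [integral_add hconst (hI1.const_mul δ⁻¹), integral_const_mul, setIntegral_const,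
            smul_eq_mul, mul_comm (μ.real _)]
      _ ≤ δ / 2 * μ.real (Metric.ball ξ (3 * h)) +
          δ⁻¹ * (δ ^ 2 * μ.real (Metric.ball ξ (3 * h))) := by gcongr
      _ = _ := by field_simp; ring
  linarith

end IsPerimeterPair

/-- A point of the reduced boundary of `Ω` near which `Ω` is confined to a thin cone around a
hyperplane cannot exist. -/
theorem not_mem_reducedBoundary_of_subset_cone (hd : 2 ≤ d) {Ω : Set (Euc d)} (hΩ : IsOpen Ω)
    {ξ e : Euc d} (hξ : ξ ∈ frontier Ω) (he : ‖e‖ = 1) {R : ℝ} (hR : 0 < R)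
    (hcone : ∀ x ∈ Ω ∩ Metric.ball ξ R, |⟪e, x - ξ⟫| ≤ 1 / 3 * ‖x - ξ‖) :
    ξ ∉ reducedBoundary Ω := by
  rintro ⟨μ, ν, hP, hpos, hlim, hn⟩
  have := hP.locallyFinite
  set n := ν ξ
  wlog hen : ⟪e, n⟫ ≤ 0 generalizing e
  · refine this (e := -e) (by rwa [norm_neg]) (fun x hx => ?_) ?_
    · rw [inner_neg_left, abs_neg]; exact hcone x hx
    · rw [inner_neg_left]; linarith
  obtain ⟨C, hC0, hC⟩ := exists_abs_deriv_smoothTransition_le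
  obtain ⟨A, hA, hiso⟩ := IsPerimeterPair.exists_isoperimetric hd
  obtain ⟨θ, hθ, hiter⟩ := exists_le_of_isoperimetric (n := d - 1) (by omega) hA
  have hd1 : d - 1 + 1 = d := by omega
  set w := volume.real (Metric.ball (0 : Euc d) 1) with hw
  have hw0 : 0 < w := ENNReal.toReal_pos (Metric.measure_ball_pos _ _ one_pos).ne'
    measure_ball_lt_top.ne
  set κ := Real.exp (-1) / 16 with hκ
  have hκ0 : 0 < κ := by positivity
  -- Chosen so that the final upper bound is exactly half of the lower bound. The factor 16^d
  -- compares the radii 4h and h/4.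
  set δ := κ * θ / (12 * C * w * 16 ^ d) with hδ
  have hδ0 : 0 < δ := by positivity
  obtain ⟨R₁, hR₁, hex₁⟩ := hP.exists_setIntegral_one_sub_inner_le hpos hn hlim
    (show (0 : ℝ) < δ ^ 2 by positivity)
  obtain ⟨R₂, hR₂, hex₂⟩ := hP.exists_setIntegral_one_sub_inner_le hpos hn hlim
    (show (0 : ℝ) < 1 / 2 by norm_num)
  set h := min R (min R₁ R₂) / 5 with hh
  have hmin : 0 < min R (min R₁ R₂) := lt_min hR (lt_min hR₁ hR₂)
  have hh0 : 0 < h := by positivity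
  have h5 : 5 * h = min R (min R₁ R₂) := by rw [hh]; ring
  have hhR : 5 * h ≤ R := h5.trans_le (min_le_left _ _)
  have hhR₁ : 5 * h ≤ R₁ := h5.trans_le ((min_le_right _ _).trans (min_le_left _ _))
  have hhR₂ : 5 * h ≤ R₂ := h5.trans_le ((min_le_right _ _).trans (min_le_right _ _))
  clear_value h
  have hfin : ∀ t, volume (Ω ∩ Metric.ball ξ t) ≠ ⊤ := fun t =>
    ((measure_mono inter_subset_right).trans_lt measure_ball_lt_top).ne
  have hlower := hiter (fun r => volume.real (Ω ∩ Metric.ball ξ r)) R₂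
    (fun r hr => by
      obtain ⟨x, hxB, hxΩ⟩ := mem_closure_iff.1 (frontier_subset_closure hξ) _
        Metric.isOpen_ball (Metric.mem_ball_self hr)
      exact ENNReal.toReal_pos ((hΩ.inter Metric.isOpen_ball).measure_pos volume
        ⟨x, hxΩ, hxB⟩).ne' (hfin r))
    (fun r t hrt => measureReal_mono (inter_subset_inter_right _ (Metric.ball_subset_ball hrt))
      (hfin t))
    (fun r t hr hrt htR => hiso hP hΩ hn hr hrt fun ρ hρ hρt => hex₂ ρ hρ (by linarith))
    (h / 4) (by positivity) (by linarith)
  simp only [hd1] at hlower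
  have hexcess := hP.volume_inter_ball_le hΩ.measurableSet hn he hen hh0 hδ0
    (fun x hx => hcone x ⟨hx.1, Metric.ball_subset_ball (by linarith) hx.2⟩)
    (hex₁ (3 * h) (by positivity) (by linarith))
  have hcut := hP.integral_cutoff_le (ξ := ξ) hΩ.measurableSet hn hC (r := 3 * h) (R := 4 * h)
    (by positivity) (by linarith) fun ρ hρ hρt => hex₂ ρ hρ (by linarith)
  have hμ : μ.real (Metric.ball ξ (3 * h)) ≤ ∫ x, cutoff ξ (3 * h) (4 * h) x ∂μ := by
    have hI : Integrable (cutoff ξ (3 * h) (4 * h)) μ :=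
      contDiff_cutoff.continuous.integrable_of_hasCompactSupport
        (hasCompactSupport_cutoff (by positivity) (by linarith))
    refine le_trans ?_ (setIntegral_le_integral (s := Metric.ball ξ (3 * h)) hI
      (Eventually.of_forall cutoff_nonneg))
    rw [setIntegral_congr_fun measurableSet_ball fun x hx =>
      cutoff_eq_one (by positivity) (by linarith) hx]
    simp
  have hvol : volume.real (Ω ∩ Metric.ball ξ (4 * h)) ≤ (4 * h) ^ d * w := by
    refine (measureReal_mono inter_subset_right measure_ball_lt_top.ne).trans (le_of_eq ?_)
    rw [measureReal_def, Measure.addHaar_ball_of_pos _ _ (by positivity), finrank_euclideanSpace_fin,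
      ENNReal.toReal_mul, ENNReal.toReal_ofReal (by positivity), hw, measureReal_def]
  have h43 : 4 * h - 3 * h = h := by ring
  rw [h43] at hcut
  have hchain : κ / h * (θ * (h / 4) ^ d) ≤
      3 / 2 * δ * (2 * (2 * C / h * ((4 * h) ^ d * w))) := by
    calc κ / h * (θ * (h / 4) ^ d) ≤ κ / h * volume.real (Ω ∩ Metric.ball ξ (h / 4)) := by gcongr
      _ ≤ 3 / 2 * δ * μ.real (Metric.ball ξ (3 * h)) := hexcess
      _ ≤ 3 / 2 * δ * (2 * (2 * C / h * volume.real (Ω ∩ Metric.ball ξ (4 * h)))) := by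
          gcongr; exact hμ.trans hcut
      _ ≤ _ := by gcongr
  have hrhs : 3 / 2 * δ * (2 * (2 * C / h * ((4 * h) ^ d * w))) =
      κ / h * (θ * (h / 4) ^ d) / 2 := by
    rw [hδ, mul_pow, div_pow, show (16 : ℝ) = 4 * 4 by norm_num, mul_pow]
    field_simp
    ring
  rw [hrhs] at hchain
  have : 0 < κ / h * (θ * (h / 4) ^ d) := by positivity
  linarith


/-! ### From approximate tangent planes to interior cones. -/

/-- Under lower regularity, an approximate tangent plane is a tangent plane: the set lies in a
slightly wider cone near the point. -/
theorem exists_forall_norm_starProjection_le {m : ℕ} {s s' : ℝ} {E : Set (Euc d)} {ξ : Euc d}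
    {V : Submodule ℝ (Euc d)} (hs : s < s') (hs' : s' ≤ 1) (hreg : WeakLowerRegularAt m E ξ)
    (hV : IsApproxTangentPlane m s E ξ V) :
    ∃ R : ℝ, 0 < R ∧ ∀ y ∈ E ∩ Metric.ball ξ R,
      ‖Vᗮ.starProjection (y - ξ)‖ ≤ s' * ‖y - ξ‖ := by
  obtain ⟨ρ, hρ, hc⟩ := hreg
  set c := ⨅ y ∈ E ∩ Metric.ball ξ ρ, ⨅ r ∈ Ioo (0 : ℝ) ρ,
      μH[(m : ℝ)] (E ∩ Metric.ball y r) / ENNReal.ofReal (r ^ m) with hcdef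
  -- Moving `y` by κ|y - ξ| changes the two sides of the cone inequality by at most (1 + s)κ|y - ξ|,
  -- which s' - s covers for positive s since s < 1. The bound 1/2 keeps the small ball inside B(ξ,
  -- 2|y - ξ|).
  set κ := min ((s' - s) / 2) (1 / 2) with hκ
  have hκ0 : 0 < κ := lt_min (by linarith) (by norm_num)
  have hκ1 : κ ≤ (s' - s) / 2 := min_le_left _ _
  have hκ2 : κ ≤ 1 / 2 := min_le_right _ _
  -- The density at scale 2r forced by a ball of radius κr, as (κr)^m = (κ/2)^m (2r)^m.
  have ha : 0 < c * ENNReal.ofReal ((κ / 2) ^ m) :=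
    ENNReal.mul_pos hc.ne' (ENNReal.ofReal_pos.2 (by positivity)).ne'
  obtain ⟨R₀, hR₀, hlt⟩ := (mem_nhdsGT_iff_exists_Ioo_subset).1
    (hV.2.2.eventually (gt_mem_nhds ha))
  replace hR₀ : 0 < R₀ := hR₀
  refine ⟨min ρ (R₀ / 2), lt_min hρ (by linarith), fun y ⟨hyE, hyB⟩ => ?_⟩
  by_contra! hy
  rw [Metric.mem_ball, dist_eq_norm, lt_min_iff] at hyB
  set r := ‖y - ξ‖ with hr
  have hr0 : 0 < r := by
    rw [hr, norm_pos_iff]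
    intro h0
    rw [hr, h0, map_zero, norm_zero, mul_zero] at hy
    exact lt_irrefl _ hy
  have h1 := hlt (show 2 * r ∈ Ioo 0 R₀ from ⟨by linarith, by linarith [hyB.2]⟩)
  simp only [mem_ofPred_eq] at h1
  have hsub : E ∩ Metric.ball y (κ * r) ⊆ (E ∩ Metric.ball ξ (2 * r)) \ tangentCone ξ V s := by
    rintro x ⟨hxE, hxB⟩
    rw [Metric.mem_ball, dist_eq_norm] at hxB
    have hxy : x - ξ = (y - ξ) + (x - y) := by abel
    have hxn : ‖x - ξ‖ ≤ r + ‖x - y‖ := by rw [hxy]; exact norm_add_le _ _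
    refine ⟨⟨hxE, ?_⟩, ?_⟩
    · rw [Metric.mem_ball, dist_eq_norm]
      nlinarith
    · simp only [tangentCone, mem_ofPred_eq, not_lt]
      have h2 : ‖Vᗮ.starProjection (y - ξ)‖ ≤
          ‖Vᗮ.starProjection (x - ξ)‖ + ‖x - y‖ := by
        have h3 : Vᗮ.starProjection (y - ξ) =
            Vᗮ.starProjection (x - ξ) - Vᗮ.starProjection (x - y) := by
          rw [← map_sub]; congr 1; abel
        rw [h3]
        exact (norm_sub_le _ _).trans (add_le_add_right
          (Submodule.norm_starProjection_apply_le _ _) _)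
      rcases le_or_gt s 0 with hs0 | hs0
      · exact (mul_nonpos_of_nonpos_of_nonneg hs0 (norm_nonneg _)).trans (norm_nonneg _)
      · have h3 : s * ‖x - ξ‖ ≤ s * (r + κ * r) :=
          mul_le_mul_of_nonneg_left (by linarith) hs0.le
        have h4 : s * (κ * r) ≤ 1 * (κ * r) :=
          mul_le_mul_of_nonneg_right (by linarith) (by positivity)
        have h5 : κ * r ≤ (s' - s) / 2 * r := mul_le_mul_of_nonneg_right hκ1 hr0.le
        linarith
  have hκr : κ * r < ρ := by nlinarith [hyB.1]
  have h4 : c ≤ μH[(m : ℝ)] (E ∩ Metric.ball y (κ * r)) / ENNReal.ofReal ((κ * r) ^ m) :=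
    (iInf₂_le y ⟨hyE, by rw [Metric.mem_ball, dist_eq_norm]; exact hyB.1⟩).trans
      (iInf₂_le (κ * r) ⟨by positivity, hκr⟩)
  have h5 := (ENNReal.mul_le_of_le_div h4).trans (measure_mono hsub)
  have hpos : ENNReal.ofReal ((2 * r) ^ m) ≠ 0 := (ENNReal.ofReal_pos.2 (by positivity)).ne'
  rw [ENNReal.div_lt_iff (Or.inl hpos) (Or.inl ENNReal.ofReal_ne_top), mul_assoc,
    ← ENNReal.ofReal_mul (by positivity), ← mul_pow] at h1
  have h6 : κ / 2 * (2 * r) = κ * r := by ring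
  rw [h6] at h1
  exact lt_irrefl _ (h5.trans_lt h1)

theorem exists_unit_normal (hd : 1 ≤ d) {V : Submodule ℝ (Euc d)}
    (hV : Module.finrank ℝ V = d - 1) :
    ∃ e : Euc d, ‖e‖ = 1 ∧ ∀ z, ‖Vᗮ.starProjection z‖ = |⟪e, z⟫| := by
  have h1 := Submodule.finrank_add_finrank_orthogonal V
  rw [hV, finrank_euclideanSpace_fin] at h1
  have h2 : Module.finrank ℝ Vᗮ = 1 := by omega
  have h3 : Vᗮ ≠ ⊥ := by
    intro h; rw [h, finrank_bot] at h2; omega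
  obtain ⟨v, hv, hv0⟩ := Submodule.exists_mem_ne_zero_of_ne_bot h3
  have hn : ‖v‖ ≠ 0 := norm_ne_zero_iff.2 hv0
  have he : ‖‖v‖⁻¹ • v‖ = 1 := by
    rw [norm_smul, norm_inv, norm_norm, inv_mul_cancel₀ hn]
  refine ⟨‖v‖⁻¹ • v, he, fun z => ?_⟩
  have h4 : (ℝ ∙ (‖v‖⁻¹ • v)) = Vᗮ := by
    refine Submodule.eq_of_le_of_finrank_eq ?_ ?_
    · rw [Submodule.span_singleton_le_iff_mem]
      exact Submodule.smul_mem _ _ hv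
    · rw [h2, finrank_span_singleton (smul_ne_zero (inv_ne_zero hn) hv0)]
  have h5 := Submodule.starProjection_unit_singleton ℝ he z
  simp only [h4] at h5
  rw [h5, norm_smul, he, mul_one, Real.norm_eq_abs]

theorem subset_or_disjoint_of_disjoint_frontier {X : Type*} [TopologicalSpace X] {U K : Set X}
    (hU : IsOpen U) (hK : IsPreconnected K) (h : Disjoint K (frontier U)) :
    K ⊆ U ∨ Disjoint K U := by
  have hcov : K ⊆ U ∪ (closure U)ᶜ := by
    intro x hx
    by_cases hxU : x ∈ U
    · exact Or.inl hxU
    · refine Or.inr fun hxc => h.le_bot ⟨hx, ?_⟩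
      rw [hU.frontier_eq]
      exact ⟨hxc, hxU⟩
  have hdisj : Disjoint U (closure U)ᶜ :=
    disjoint_compl_right.mono_left subset_closure
  rcases hK.subset_or_subset hU isClosed_closure.isOpen_compl hdisj hcov with h1 | h1
  · exact Or.inl h1
  · exact Or.inr (hdisj.symm.mono_left h1)

/-- At a regular tangent point in the reduced boundary, one of the two components of the
complement of the tangent cone lies in the set. -/
theorem exists_truncCone_subset (hd : 2 ≤ d) {Ω : Set (Euc d)} (hΩ : IsOpen Ω) {s : ℝ}
    (hs : s < 1 / 3) {ξ : Euc d} (ht : ξ ∈ tangentPoints (d - 1) s (frontier Ω))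
    (hr : ξ ∈ reducedBoundary Ω) (hw : WeakLowerRegularAt (d - 1) (frontier Ω) ξ) :
    ∃ e : Euc d, ‖e‖ = 1 ∧ ∃ R : ℝ, 0 < R ∧ truncCone ξ e (1 / 3) R ⊆ Ω := by
  obtain ⟨hξ, V, hV⟩ := ht
  obtain ⟨R, hR, hcone⟩ := exists_forall_norm_starProjection_le hs (by norm_num) hw hV
  obtain ⟨e, he, hVe⟩ := exists_unit_normal (by omega) hV.1
  by_contra! hcon
  -- Applied to `e` and `-e`: a convex cone missing the boundary and not contained in Ω is disjoint
  -- from it. Both together would confine Ω to the thin cone.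
  have key : ∀ e' : Euc d, ‖e'‖ = 1 → (∀ z, |⟪e', z⟫| = |⟪e, z⟫|) →
      Disjoint (truncCone ξ e' (1 / 3) R) Ω := by
    intro e' he' hee
    refine (subset_or_disjoint_of_disjoint_frontier hΩ
      (convex_truncCone ξ e' (by norm_num) R).isPreconnected ?_).resolve_left
      (hcon e' he' R hR)
    refine Set.disjoint_left.2 fun x hx hxf => ?_
    have h1 := hcone x ⟨hxf, hx.2⟩
    have h2 := hx.1
    rw [hVe, ← hee] at h1
    simp only [mem_ofPred_eq] at h2
    linarith [le_abs_self ⟪e', x - ξ⟫]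
  have h1 := key e he fun _ => rfl
  have h2 := key (-e) (by rwa [norm_neg]) fun z => by rw [inner_neg_left, abs_neg]
  refine not_mem_reducedBoundary_of_subset_cone hd hΩ hξ he hR (fun x hx => ?_) hr
  refine abs_le.2 ⟨?_, ?_⟩
  · by_contra! hlt
    refine Set.disjoint_left.1 h2 (show x ∈ truncCone ξ (-e) (1 / 3) R from ⟨?_, hx.2⟩) hx.1
    simp only [mem_ofPred_eq, inner_neg_left]; linarith
  · by_contra! hlt
    exact Set.disjoint_left.1 h1 (show x ∈ truncCone ξ e (1 / 3) R from ⟨hlt, hx.2⟩) hx.1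

end LipGraphs

/-! ### The countable decomposition. -/

open LipGraphs in
theorem mainTheorem3 (d : ℕ) (hd : 2 ≤ d) (Ω : Set (LipGraphs.Euc d)) (hΩ : IsOpen Ω)
    (hreg : LipGraphs.WeakLowerADR (d - 1) (frontier Ω))
    (hfin : IsLocallyFiniteMeasure ((μH[((d - 1 : ℕ) : ℝ)]).restrict (frontier Ω)))
    (hred : μH[((d - 1 : ℕ) : ℝ)] (frontier Ω \ LipGraphs.reducedBoundary Ω) = 0)
    (s : ℝ) (hs₀ : 0 < s) (hs₁ : s < 1 / 3) :
    ∃ G : Set (Set (LipGraphs.Euc d)), G.Countable ∧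
      (∀ Γ ∈ G, LipGraphs.IsLipschitzGraph (d - 1) Γ) ∧
      ⋃₀ G = {ξ ∈ LipGraphs.tangentPoints (d - 1) s (frontier Ω) ∩ LipGraphs.reducedBoundary Ω |
        LipGraphs.WeakLowerRegularAt (d - 1) (frontier Ω) ξ} ∧
      μH[((d - 1 : ℕ) : ℝ)] (LipGraphs.tangentPoints (d - 1) s (frontier Ω) \ ⋃₀ G) = 0 ∧
      ∀ Γ ∈ G, ∃ D : Set (LipGraphs.Euc d),
        LipGraphs.IsBoundedLipschitzDomain D ∧ D ⊆ Ω ∧ Γ ⊆ frontier D := by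
  set F := {ξ ∈ tangentPoints (d - 1) s (frontier Ω) ∩ reducedBoundary Ω |
    WeakLowerRegularAt (d - 1) (frontier Ω) ξ} with hF
  obtain ⟨S, hSc, hSd⟩ := TopologicalSpace.exists_countable_dense (Metric.sphere (0 : Euc d) 1)
  obtain ⟨Q, hQc, hQd⟩ := TopologicalSpace.exists_countable_dense (Euc d)
  let piece : Metric.sphere (0 : Euc d) 1 × ℕ × Euc d → Set (Euc d) := fun i =>
    {ξ ∈ F | truncCone ξ (i.1 : Euc d) (1 / 2) (1 / ((i.2.1 : ℝ) + 1)) ⊆ Ω ∧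
      ξ ∈ Metric.ball i.2.2 (1 / ((i.2.1 : ℝ) + 1) / 16)}
  let I : Set (Metric.sphere (0 : Euc d) 1 × ℕ × Euc d) := S ×ˢ (univ ×ˢ Q)
  have hunit : ∀ u : Metric.sphere (0 : Euc d) 1, ‖(u : Euc d)‖ = 1 := fun u => by
    simp
  -- Empty pieces are discarded because their union of cones would be empty, hence not a domain.
  have hGunion : ⋃₀ (piece '' I \ {∅}) = F := by
    refine Subset.antisymm ?_ fun ξ hξ => ?_
    · rintro ξ ⟨_, ⟨⟨i, -, rfl⟩, -⟩, hξ⟩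
      exact hξ.1
    · obtain ⟨e, he, R, hR, hsub⟩ := exists_truncCone_subset hd hΩ hs₁ hξ.1.1 hξ.1.2 hξ.2
      obtain ⟨u, hu, hue⟩ := hSd.exists_dist_lt ⟨e, by simpa using he⟩
        (show (0 : ℝ) < 1 / 6 by norm_num)
      obtain ⟨n, hn⟩ := exists_nat_one_div_lt hR
      obtain ⟨q, hq, hξq⟩ := hQd.exists_dist_lt ξ
        (show (0 : ℝ) < 1 / ((n : ℝ) + 1) / 16 by positivity)
      have hmem : ξ ∈ piece (u, n, q) := by
        refine ⟨hξ, ?_, hξq⟩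
        refine (truncCone_subset_of_norm_sub_lt ξ (e := e) ?_ _).trans
          ((truncCone_mono ξ e _ hn.le).trans hsub)
        rw [Subtype.dist_eq, dist_comm, dist_eq_norm] at hue
        exact hue.le
      exact ⟨piece (u, n, q), ⟨⟨_, ⟨hu, mem_univ _, hq⟩, rfl⟩, (nonempty_of_mem hmem).ne_empty⟩,
        hmem⟩
  -- The cone lies in the open set Ω, which contains none of its boundary points.
  have hout : ∀ i, ∀ x ∈ piece i, ∀ y ∈ piece i,
      y ∉ truncCone x (i.1 : Euc d) (1 / 2) (1 / ((i.2.1 : ℝ) + 1)) := by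
    intro i x hx y hy hyx
    have h1 : y ∈ frontier Ω := hy.1.1.1.1
    rw [hΩ.frontier_eq] at h1
    exact h1.2 (hx.2.1 hyx)
  refine ⟨piece '' I \ {∅}, ?_, ?_, hGunion, ?_, ?_⟩
  · exact ((hSc.prod (countable_univ.prod hQc)).image _).mono sdiff_subset
  · rintro _ ⟨⟨i, -, rfl⟩, -⟩
    refine isLipschitzGraph_of_inner_le (hunit i.1) fun x hx y hy => ?_
    by_contra! hlt
    refine hout i x hx y hy ⟨hlt, ?_⟩
    have h1 := hx.2.2
    have h2 := hy.2.2
    have h3 : 0 < 1 / ((i.2.1 : ℝ) + 1) := by positivity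
    rw [Metric.mem_ball] at h1 h2 ⊢
    linarith [dist_triangle_right y x i.2.2]
  · rw [hGunion]
    -- A tangent point outside `F` either fails lower regularity or lies outside the reduced
    -- boundary.
    refine measure_mono_null ?_ (measure_union_null hreg hred)
    rintro ξ ⟨hξ, hξF⟩
    by_cases h1 : WeakLowerRegularAt (d - 1) (frontier Ω) ξ
    · exact Or.inr ⟨hξ.1, fun h2 => hξF ⟨⟨hξ, h2⟩, h1⟩⟩
    · exact Or.inl ⟨hξ.1, h1⟩
  · rintro _ ⟨⟨i, -, rfl⟩, hne⟩
    have hne' : (piece i).Nonempty := nonempty_iff_ne_empty.2 hne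
    have hpos : 0 < 1 / ((i.2.1 : ℝ) + 1) := by positivity
    have hsub : (⋃ ξ ∈ piece i, truncCone ξ (i.1 : Euc d) (1 / 2) (1 / ((i.2.1 : ℝ) + 1))) ⊆ Ω :=
      iUnion₂_subset fun ξ hξ => hξ.2.1
    have hD := isBoundedLipschitzDomain_iUnion_truncCone hne' (hunit i.1) hpos
      (q := i.2.2) fun ξ hξ => hξ.2.2
    refine ⟨_, hD, hsub, fun ξ hξ => ?_⟩
    rw [hD.isOpen.frontier_eq]
    refine ⟨closure_mono (subset_biUnion_of_mem (u := fun ξ => truncCone ξ (i.1 : Euc d) (1 / 2)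
      (1 / ((i.2.1 : ℝ) + 1))) hξ)
      (mem_closure_truncCone ξ (hunit i.1) (by norm_num) hpos), fun hmem => ?_⟩
    have h1 : ξ ∈ frontier Ω := hξ.1.1.1.1
    rw [hΩ.frontier_eq] at h1
    exact h1.2 (hsub hmem)
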